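/- Let $\mathfrak{ns}(2)$ be the $N=2$ Neveu-Schwarz Lie superalgebra, with basis $L_n, J_n$ ($n\in\mathbb Z$), $G^\pm_r$ ($r\in\mathbb Z+\frac12$) and central element $C$. For $c,h,q\in\mathbb C$ let $L(c,h,q)$ be the irreducible lowest weight $\mathfrak{ns}(2)$-module (the quotient of the Verma module by its maximal proper submodule) whose lowest weight vector $\mathbf 1_{c,h,q}$ is annihilated by all positive modes and satisfies $L(0)\mathbf 1_{c,h,q}=h\mathbf 1_{c,h,q}$, $J(0)\mathbf 1_{c,h,q}=q\mathbf 1_{c,h,q}$, $C\mathbf 1_{c,h,q}=c\mathbf 1_{c,h,q}$; we write $L(n),J(n),G^\pm(r)$ for the action of the basis elements. Let $m\ge 0$ be an integer, $c_m=\frac{3m}{m+2}$, and for $j,k\in\{\frac12,\frac32,\frac52,\dots\}$ put $h_m^{j,k}=\frac{jk-1/4}{m+2}$ and $q_m^{j,k}=\frac{j-k}{m+2}$. Regard $L(c_m,0,0)$ as an $N=2$ superconformal vertex operator superalgebra with vacuum $\mathbf 1=\mathbf 1_{c_m,0,0}$, Neveu-Schwarz elements $G^\pm(-\frac32)\mathbf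 1$, $U(1)$-current $J(-1)\mathbf 1$ and Virasoro element $L(-2)\mathbf 1$. For $i=1,2,3$ let $j_i,k_i\in\{\frac12,\frac32,\dots\}$ with $j_i+k_i<m+2$, let $h_i=h_m^{j_i,k_i}$, $q_i=q_m^{j_i,k_i}$, and let $W_i=L(c_m,h_i,q_i)$, an irreducible $L(c_m,0,0)$-module on which the modes of these four elements act as the corresponding elements of $\mathfrak{ns}(2)$, with even part the weights in $h_i+\mathbb Z$ and odd part the weights in $h_i+\mathbb Z+\frac12$. Let $w_{(i)}=\mathbf 1_{c_m,h_i,q_i}$ and $\Delta=h_3-h_1-h_2$. Write $\mathcal Y(w,x)=\sum_{n\in\mathbb C}w_n x^{-n-1}$ for an intertwining operator $\mathcal Y$ of type $\binom{W_3}{W_1\,W_2}$, i.e. a linear map $W_1\otimes W_2\to W_3\{x\}$ that is lower truncated and satisfies the Jacobi identity (with sign $(-1)^{|u||w|}$) and the $L(-1)$-derivative property. Then: 1. For every such $\mathcal Y$ and all $w\in W_1$, $v\in W_2$, $\mathcal Y(w,x)v\in x^{\Delta}W_3((x^{1/2}))$. 2. For every such $\mathcal Y$ the four operators $$(w_{(1)})_{-\Delta-1},\quad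 (G^+(-\tfrac12)w_{(1)})_{-\Delta-1/2},\quad (G^-(-\tfrac12)w_{(1)})_{-\Delta-1/2},\quad (G^+(-\tfrac12)G^-(-\tfrac12)w_{(1)})_{-\Delta}$$ map $\mathbb C w_{(2)}$ to $\mathbb C w_{(3)}$, and $\mathcal Y$ is uniquely determined by these four maps $\mathbb C w_{(2)}\to\mathbb C w_{(3)}$; in particular, if they are all $0$, then $\mathcal Y=0$. 3. Let $\mathcal V$ be the vector space of intertwining operators of type $\binom{W_3}{W_1\,W_2}$. If $q_3\notin\{q_1+q_2,\ q_1+q_2-1,\ q_1+q_2+1\}$, then $\mathcal V=0$. If $q_3=q_1+q_2+1$ or $q_3=q_1+q_2-1$, then $\dim\mathcal V\le 1$. If $q_3=q_1+q_2$, then $\dim\mathcal V\le 2$. -/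

import Mathlib

open Filter

noncomputable section

/-! ### The `N = 2` Neveu-Schwarz Lie superalgebra and its irreducible lowest weight modules -/

/-- The basis of the `N = 2` Neveu-Schwarz Lie superalgebra `𝔫𝔰(2)`.  The odd elements are indexed
by integers: `Gp k` is `G⁺_{k+1/2}` and `Gm k` is `G⁻_{k+1/2}`. -/
inductive NS2Gen : Type
  | L (n : ℤ)
  | J (n : ℤ)
  | Gp (k : ℤ)
  | Gm (k : ℤ)
  | C

namespace NS2

/-- A basis element of `𝔫𝔰(2)`, as a generator of the free associative algebra. -/
abbrev gen (g : NS2Gen) : FreeAlgebra ℂ NS2Gen := FreeAlgebra.ι ℂ g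

/-- Kronecker's `δ_{n,0}`. -/
abbrev delta (n : ℤ) : ℂ := if n = 0 then 1 else 0

open NS2Gen in
/-- The `N = 2` Neveu-Schwarz relations: commutators, except that the bracket of two odd elements is
the anticommutator.  With `r = k + 1/2` and `s = l + 1/2` one has `r + s = k + l + 1`,
`r - s = k - l` and `r² - 1/4 = k (k + 1)`. -/
inductive Rel : FreeAlgebra ℂ NS2Gen → FreeAlgebra ℂ NS2Gen → Prop
  | central (g : NS2Gen) : Rel (gen C * gen g) (gen g * gen C)
  | LL (m n : ℤ) : Rel (gen (L m) * gen (L n) - gen (L n) * gen (L m))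
      (((m : ℂ) - n) • gen (L (m + n)) + (((m : ℂ) ^ 3 - m) / 12 * delta (m + n)) • gen C)
  | JJ (m n : ℤ) : Rel (gen (J m) * gen (J n) - gen (J n) * gen (J m))
      (((m : ℂ) / 3 * delta (m + n)) • gen C)
  | LJ (m n : ℤ) : Rel (gen (L m) * gen (J n) - gen (J n) * gen (L m))
      ((-(n : ℂ)) • gen (J (m + n)))
  | LGp (m k : ℤ) : Rel (gen (L m) * gen (Gp k) - gen (Gp k) * gen (L m))
      (((m : ℂ) / 2 - (k + 1 / 2)) • gen (Gp (m + k)))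
  | LGm (m k : ℤ) : Rel (gen (L m) * gen (Gm k) - gen (Gm k) * gen (L m))
      (((m : ℂ) / 2 - (k + 1 / 2)) • gen (Gm (m + k)))
  | JGp (m k : ℤ) : Rel (gen (J m) * gen (Gp k) - gen (Gp k) * gen (J m)) (gen (Gp (m + k)))
  | JGm (m k : ℤ) : Rel (gen (J m) * gen (Gm k) - gen (Gm k) * gen (J m)) (-gen (Gm (m + k)))
  | GpGm (k l : ℤ) : Rel (gen (Gp k) * gen (Gm l) + gen (Gm l) * gen (Gp k))
      ((2 : ℂ) • gen (L (k + l + 1)) + ((k : ℂ) - l) • gen (J (k + l + 1)) +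
        (((k + 1 / 2 : ℂ) ^ 2 - 1 / 4) / 3 * delta (k + l + 1)) • gen C)
  | GpGp (k l : ℤ) : Rel (gen (Gp k) * gen (Gp l) + gen (Gp l) * gen (Gp k)) 0
  | GmGm (k l : ℤ) : Rel (gen (Gm k) * gen (Gm l) + gen (Gm l) * gen (Gm k)) 0

/-- The universal enveloping algebra `U(𝔫𝔰(2))`. -/
abbrev U : Type := RingQuot Rel

/-- A basis element of `𝔫𝔰(2)` inside the universal enveloping algebra. -/
def ι (g : NS2Gen) : U := RingQuot.mkAlgHom ℂ Rel (gen g)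

/-- The left ideal generated by `𝔫𝔰⁺(2)`, `L₀ - h`, `J₀ - q` and `C - c`. -/
def vermaIdeal (c h q : ℂ) : Submodule U U :=
  Submodule.span U
    ({x | ∃ n : ℤ, 0 < n ∧ (x = ι (.L n) ∨ x = ι (.J n))} ∪
      {x | ∃ k : ℤ, 0 ≤ k ∧ (x = ι (.Gp k) ∨ x = ι (.Gm k))} ∪
      {ι (.L 0) - algebraMap ℂ U h, ι (.J 0) - algebraMap ℂ U q, ι .C - algebraMap ℂ U c})

/-- The Verma module `M(c, h, q)`: the `𝔫𝔰(2)`-module induced from the one-dimensional module of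
the subalgebra spanned by `𝔫𝔰⁺(2)`, `L₀`, `J₀`, `C`. -/
abbrev Verma (c h q : ℂ) : Type := U ⧸ vermaIdeal c h q

/-- The maximal proper submodule of the Verma module. -/
def maxProper (c h q : ℂ) : Submodule U (Verma c h q) :=
  sSup {N | N ≠ ⊤}

/-- The irreducible lowest weight module `L(c, h, q)`. -/
abbrev Irr (c h q : ℂ) : Type := Verma c h q ⧸ maxProper c h q

/-- The lowest weight vector `𝟏_{c,h,q}` of `L(c, h, q)`. -/
def lowest (c h q : ℂ) : Irr c h q :=
  (maxProper c h q).mkQ ((vermaIdeal c h q).mkQ 1)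

/-- The representation image of a basis element of `𝔫𝔰(2)` on `L(c, h, q)`. -/
def act {c h q : ℂ} (g : NS2Gen) : Module.End ℂ (Irr c h q) :=
  Algebra.lsmul ℂ ℂ (Irr c h q) (ι g)

end NS2

/-! ### Vertex operator superalgebras, modules and intertwining operators -/

section General

variable {V W W₁ W₂ W₃ : Type*}
  [AddCommGroup V] [Module ℂ V] [AddCommGroup W] [Module ℂ W]
  [AddCommGroup W₁] [Module ℂ W₁] [AddCommGroup W₂] [Module ℂ W₂]
  [AddCommGroup W₃] [Module ℂ W₃]

/-- The mode `u_n`, the coefficient of `x^{-n-1}` in `Y(u, x)`. -/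
def vmode (Y : V →ₗ[ℂ] VertexOperator ℂ W) (u : V) (n : ℤ) : Module.End ℂ W :=
  VertexOperator.ncoeff (Y u) n

/-- For an operator `L0` (the operator `L(0)`) and `h : ℂ`, the sum of the weight spaces with weights
in `h + ℤ` (for `i = 0`) or in `h + ℤ + 1/2` (for `i = 1`). -/
def weightSign (L0 : Module.End ℂ W) (h : ℂ) (i : ZMod 2) : Submodule ℂ W :=
  ⨆ n : ℤ, L0.eigenspace (h + n + (i.val : ℂ) / 2)

/-- The Jacobi identity
`x₀⁻¹ δ((x₁-x₂)/x₀) Y₃(u,x₁) I(w,x₂) v - (-1)^{|u||w|} x₀⁻¹ δ((x₂-x₁)/(-x₀)) I(w,x₂) Y₂(u,x₁) v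
  = x₂⁻¹ δ((x₁-x₀)/x₂) I(Y₁(u,x₀)w,x₂) v`
for `u`, `w` even or odd, where `I(w,x) = ∑_{n : A} I n w x^{-n-1}`.  It is written out coefficient by
coefficient: the coefficients of `x₀^{-l-1} x₁^{-m-1} x₂^{-n-1}` on the two sides are
`∑_{t ≥ 0} (-1)^t (l choose t) (u_{l+m-t} w_{n+t} v - (-1)^{|u||w|} (-1)^l w_{n+l-t} u_{m+t} v)` and
`∑_{t ≥ 0} (m choose t) (u_{l+t} w)_{m+n-t} v`.
These sums have only finitely many nonzero terms when `Y₁`, `Y₂`, `I` are lower truncated; they are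
written as partial sums with sufficiently many terms. -/
def JacobiIdentity {A : Type*} [AddGroupWithOne A]
    (signV : ZMod 2 → Submodule ℂ V) (sign₁ : ZMod 2 → Submodule ℂ W₁)
    (Y₁ : V →ₗ[ℂ] VertexOperator ℂ W₁) (Y₂ : V →ₗ[ℂ] VertexOperator ℂ W₂)
    (Y₃ : V →ₗ[ℂ] VertexOperator ℂ W₃) (I : A → W₁ → W₂ → W₃) : Prop :=
  ∀ (i j : ZMod 2), ∀ u ∈ signV i, ∀ w ∈ sign₁ j, ∀ (v : W₂) (l m : ℤ) (n : A),
    ∀ᶠ T : ℕ in atTop,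
      ∑ t ∈ Finset.range T, ((-1 : ℂ) ^ t * (Ring.choose l t : ℤ)) •
          (vmode Y₃ u (l + m - t) (I (n + t) w v) -
            ((-1 : ℂ) ^ (i.val * j.val) * (-1 : ℂ) ^ l) •
              I (n + l - t) w (vmode Y₂ u (m + t) v)) =
        ∑ t ∈ Finset.range T, ((Ring.choose m t : ℤ) : ℂ) •
          I (m + n - t) (vmode Y₁ u (l + t) w) v

/-- The modes of `L` satisfy the Virasoro relations with central charge `c`. -/
def VirasoroRelations (L : ℤ → Module.End ℂ W) (c : ℂ) : Prop :=
  ∀ m n : ℤ, L m * L n - L n * L m =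
    ((m : ℂ) - n) • L (m + n) + (c / 12 * ((m : ℂ) ^ 3 - m) * NS2.delta (m + n)) • 1

variable (V) in
/-- A vertex operator superalgebra `(V, Y, 𝟏, ω)` of central charge `c`.  The weight spaces are the
eigenspaces of `L(0) = ω_1` (which are independent), the weights lie in `½ℤ`, and the even and odd
parts consist of the integral and of the half-integral weights. -/
structure VOSA where
  Y : V →ₗ[ℂ] VertexOperator ℂ V
  one : V
  omega : V
  centralCharge : ℂ
  weight_iSup : ⨆ n : ℤ, (vmode Y omega 1).eigenspace ((n : ℂ) / 2) = ⊤
  weight_finite : ∀ n : ℤ, FiniteDimensional ℂ ((vmode Y omega 1).eigenspace ((n : ℂ) / 2))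
  weight_bounded : ∃ N : ℤ, ∀ n < N, (vmode Y omega 1).eigenspace ((n : ℂ) / 2) = ⊥
  one_weight : one ∈ (vmode Y omega 1).eigenspace 0
  omega_weight : omega ∈ (vmode Y omega 1).eigenspace 2
  /-- `Y(𝟏, x) = 1`. -/
  vacuum : ∀ n : ℤ, vmode Y one n = if n = -1 then 1 else 0
  /-- `Y(v, x)𝟏 ∈ V[[x]]` with constant term `v`. -/
  creation : ∀ v : V, (∀ n : ℤ, 0 ≤ n → vmode Y v n one = 0) ∧ vmode Y v (-1) one = v
  jacobi : JacobiIdentity (weightSign (vmode Y omega 1) 0) (weightSign (vmode Y omega 1) 0)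
    Y Y Y (fun (n : ℤ) u v => vmode Y u n v)
  virasoro : VirasoroRelations (fun n => vmode Y omega (n + 1)) centralCharge
  /-- `Y(L(-1)u, x) = d/dx Y(u, x)`. -/
  derivative : ∀ (u : V) (n : ℤ),
    vmode Y (vmode Y omega 0 u) n = (-(n : ℂ)) • vmode Y u (n - 1)

/-- The sign grading `V = V⁰ ⊕ V¹`. -/
def VOSA.sign (A : VOSA V) : ZMod 2 → Submodule ℂ V := weightSign (vmode A.Y A.omega 1) 0

variable (V) in
/-- An `N = 2` superconformal vertex operator superalgebra.  Here `L(n) = ω_{n+1}`, `J(n) = μ_n` and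
`G^±(k + 1/2) = τ^±_{k+1}`. -/
structure N2VOSA extends VOSA V where
  taup : V
  taum : V
  mu : V
  taup_odd : taup ∈ toVOSA.sign 1
  taum_odd : taum ∈ toVOSA.sign 1
  mu_even : mu ∈ toVOSA.sign 0
  /-- `V` is the direct sum of the eigenspaces of `J(0)` with integral eigenvalues, which modulo `2ℤ`
  give the sign grading. -/
  sign_eq : ∀ i : ZMod 2,
    toVOSA.sign i = ⨆ p : {p : ℤ // (p : ZMod 2) = i}, (vmode Y mu 0).eigenspace ((p : ℤ) : ℂ)
  JJ : ∀ m n : ℤ, vmode Y mu m * vmode Y mu n - vmode Y mu n * vmode Y mu m =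
    (centralCharge / 3 * m * NS2.delta (m + n)) • 1
  LJ : ∀ m n : ℤ, vmode Y omega (m + 1) * vmode Y mu n - vmode Y mu n * vmode Y omega (m + 1) =
    (-(n : ℂ)) • vmode Y mu (m + n)
  LGp : ∀ m k : ℤ,
    vmode Y omega (m + 1) * vmode Y taup (k + 1) - vmode Y taup (k + 1) * vmode Y omega (m + 1) =
      ((m : ℂ) / 2 - (k + 1 / 2)) • vmode Y taup (m + k + 1)
  LGm : ∀ m k : ℤ,
    vmode Y omega (m + 1) * vmode Y taum (k + 1) - vmode Y taum (k + 1) * vmode Y omega (m + 1) =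
      ((m : ℂ) / 2 - (k + 1 / 2)) • vmode Y taum (m + k + 1)
  JGp : ∀ m k : ℤ,
    vmode Y mu m * vmode Y taup (k + 1) - vmode Y taup (k + 1) * vmode Y mu m =
      vmode Y taup (m + k + 1)
  JGm : ∀ m k : ℤ,
    vmode Y mu m * vmode Y taum (k + 1) - vmode Y taum (k + 1) * vmode Y mu m =
      -vmode Y taum (m + k + 1)
  GpGm : ∀ k l : ℤ,
    vmode Y taup (k + 1) * vmode Y taum (l + 1) + vmode Y taum (l + 1) * vmode Y taup (k + 1) =
      (2 : ℂ) • vmode Y omega (k + l + 1 + 1) + ((k : ℂ) - l) • vmode Y mu (k + l + 1) +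
        (centralCharge / 3 * ((k + 1 / 2 : ℂ) ^ 2 - 1 / 4) * NS2.delta (k + l + 1)) • 1
  GpGp : ∀ k l : ℤ,
    vmode Y taup (k + 1) * vmode Y taup (l + 1) + vmode Y taup (l + 1) * vmode Y taup (k + 1) = 0
  GmGm : ∀ k l : ℤ,
    vmode Y taum (k + 1) * vmode Y taum (l + 1) + vmode Y taum (l + 1) * vmode Y taum (k + 1) = 0

variable (W) in
/-- A module `W` for a vertex operator superalgebra, `ℂ`-graded by the eigenvalues of `L(0)` and
`ℤ/2`-graded by sign. -/
structure VOSAModule (A : VOSA V) where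
  Y : V →ₗ[ℂ] VertexOperator ℂ W
  sign : ZMod 2 → Submodule ℂ W
  sign_isCompl : IsCompl (sign 0) (sign 1)
  mode_sign : ∀ (i j : ZMod 2), ∀ u ∈ A.sign i, ∀ w ∈ sign j, ∀ n : ℤ,
    vmode Y u n w ∈ sign (i + j)
  weight_iSup : ⨆ z : ℂ, (vmode Y A.omega 1).eigenspace z = ⊤
  weight_finite : ∀ z : ℂ, FiniteDimensional ℂ ((vmode Y A.omega 1).eigenspace z)
  weight_bounded : ∃ B : ℝ, ∀ z : ℂ, z.re < B → (vmode Y A.omega 1).eigenspace z = ⊥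
  vacuum : ∀ n : ℤ, vmode Y A.one n = if n = -1 then 1 else 0
  jacobi : JacobiIdentity A.sign A.sign A.Y Y Y (fun (n : ℤ) u w => vmode Y u n w)
  virasoro : VirasoroRelations (fun n => vmode Y A.omega (n + 1)) A.centralCharge
  derivative : ∀ (u : V) (n : ℤ),
    vmode Y (vmode A.Y A.omega 0 u) n = (-(n : ℂ)) • vmode Y u (n - 1)

/-- `I n w₁ w₂` is the coefficient `(w₁)_n w₂` of `x^{-n-1}`, `n ∈ ℂ`, in `𝒴(w₁, x) w₂ ∈ W₃{x}`.  It
is an intertwining operator of type `(W₃ over W₁ W₂)` if it is lower truncated, and satisfies the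
Jacobi identity and the `L(-1)`-derivative property `𝒴(L(-1)w₁, x) = d/dx 𝒴(w₁, x)`. -/
structure IsIntertwiningOperator {A : VOSA V} (M₁ : VOSAModule W₁ A) (M₂ : VOSAModule W₂ A)
    (M₃ : VOSAModule W₃ A) (I : ℂ → W₁ →ₗ[ℂ] W₂ →ₗ[ℂ] W₃) : Prop where
  truncation : ∀ (w₁ : W₁) (w₂ : W₂) (n : ℂ), ∀ᶠ t : ℕ in atTop, I (n + t) w₁ w₂ = 0
  jacobi : JacobiIdentity A.sign M₁.sign M₁.Y M₂.Y M₃.Y (fun (n : ℂ) w₁ w₂ => I n w₁ w₂)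
  derivative : ∀ (w₁ : W₁) (n : ℂ),
    I n (vmode M₁.Y A.omega 0 w₁) = (-n) • I (n - 1) w₁

/-- The space of intertwining operators of type `(W₃ over W₁ W₂)`. -/
def intertwiningOperators {A : VOSA V} (M₁ : VOSAModule W₁ A) (M₂ : VOSAModule W₂ A)
    (M₃ : VOSAModule W₃ A) : Submodule ℂ (ℂ → W₁ →ₗ[ℂ] W₂ →ₗ[ℂ] W₃) where
  carrier := {I | IsIntertwiningOperator M₁ M₂ M₃ I}
  zero_mem' :=
    { truncation := fun _ _ _ => Eventually.of_forall fun _ => rfl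
      jacobi := fun i j u _ w _ v l m n => Eventually.of_forall fun T => by simp
      derivative := fun _ _ => by simp }
  add_mem' {I I'} hI hI' :=
    { truncation := fun w₁ w₂ n => by
        filter_upwards [hI.truncation w₁ w₂ n, hI'.truncation w₁ w₂ n] with t h h'
        simp [h, h']
      jacobi := fun i j u hu w hw v l m n => by
        filter_upwards [hI.jacobi i j u hu w hw v l m n, hI'.jacobi i j u hu w hw v l m n]
          with T h h'
        simp only [Pi.add_apply, LinearMap.add_apply, map_add, smul_add, Finset.sum_add_distrib]
        rw [← h, ← h', ← Finset.sum_add_distrib]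
        refine Finset.sum_congr rfl fun t _ => ?_
        module
      derivative := fun w₁ n => by
        simp [hI.derivative, hI'.derivative] }
  smul_mem' r I hI :=
    { truncation := fun w₁ w₂ n => by
        filter_upwards [hI.truncation w₁ w₂ n] with t h
        simp [h]
      jacobi := fun i j u hu w hw v l m n => by
        filter_upwards [hI.jacobi i j u hu w hw v l m n] with T h
        have h2 := congrArg (fun x => r • x) h
        simp only [Finset.smul_sum] at h2
        simp only [Pi.smul_apply, LinearMap.smul_apply, map_smul]
        refine Eq.trans (Finset.sum_congr rfl fun t _ => ?_)
          (h2.trans (Finset.sum_congr rfl fun t _ => ?_)) <;> module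
      derivative := fun w₁ n => by
        rw [Pi.smul_apply, Pi.smul_apply, LinearMap.smul_apply, LinearMap.smul_apply,
          hI.derivative, smul_comm] }

end General

/-! ### The vertex operator superalgebra `L(c, 0, 0)` and its modules `L(c, h, q)` -/

/-- The modes of `Y(ω, x)`, `Y(μ, x)`, `Y(τ^±, x)` on `L(c, h, q)` are the representation images of
the elements of `𝔫𝔰(2)`. -/
structure NS2Compatible {V : Type*} [AddCommGroup V] [Module ℂ V] (A : N2VOSA V) {c h q : ℂ}
    (Y : V →ₗ[ℂ] VertexOperator ℂ (NS2.Irr c h q)) : Prop where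
  L : ∀ n : ℤ, vmode Y A.omega (n + 1) = NS2.act (.L n)
  J : ∀ n : ℤ, vmode Y A.mu n = NS2.act (.J n)
  Gp : ∀ k : ℤ, vmode Y A.taup (k + 1) = NS2.act (.Gp k)
  Gm : ∀ k : ℤ, vmode Y A.taum (k + 1) = NS2.act (.Gm k)

/-- The `N = 2` superconformal vertex operator superalgebra structure on the irreducible module
`L(c, 0, 0)`: the vacuum is `𝟏_{c,0,0}`, and the Neveu-Schwarz elements `G^±(-3/2)𝟏`, the element
`J(-1)𝟏` and the Virasoro element `L(-2)𝟏` generate the action of `𝔫𝔰(2)`.  There is at most one such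
structure, because `L(c, 0, 0)` is generated by `𝟏_{c,0,0}` over `𝔫𝔰(2)`. -/
structure IrrVOSA (c : ℂ) extends N2VOSA (NS2.Irr c 0 0) where
  centralCharge_eq : centralCharge = c
  one_eq : one = NS2.lowest c 0 0
  taup_eq : taup = NS2.act (.Gp (-2)) (NS2.lowest c 0 0)
  taum_eq : taum = NS2.act (.Gm (-2)) (NS2.lowest c 0 0)
  mu_eq : mu = NS2.act (.J (-1)) (NS2.lowest c 0 0)
  omega_eq : omega = NS2.act (.L (-2)) (NS2.lowest c 0 0)
  compatible : NS2Compatible toN2VOSA Y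

/-- The structure of a module for the vertex operator superalgebra `L(c, 0, 0)` on the irreducible
`𝔫𝔰(2)`-module `L(c, h, q)`.  The even part has the weights in `h + ℤ`, the odd part those in
`h + ℤ + 1/2`.  There is at most one such structure. -/
structure IrrModule {c : ℂ} (A : IrrVOSA c) (h q : ℂ)
    extends VOSAModule (NS2.Irr c h q) A.toVOSA where
  sign_eq : sign = weightSign (NS2.act (.L 0)) h
  compatible : NS2Compatible A.toN2VOSA Y

/-! ### The unitary minimal models -/

/-- `ℕ_{1/2} = {1/2, 3/2, 5/2, …}`. -/
def NHalf : Set ℚ := {x | ∃ a : ℕ, x = a + 1 / 2}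

/-- `c_m = 3m/(m+2)`. -/
def cMin (m : ℕ) : ℂ := 3 * m / (m + 2)

/-- `h_m^{j,k} = (jk - 1/4)/(m+2)`. -/
def hMin (m : ℕ) (j k : ℚ) : ℂ := (j * k - 1 / 4) / (m + 2)

/-- `q_m^{j,k} = (j-k)/(m+2)`. -/
def qMin (m : ℕ) (j k : ℚ) : ℂ := (j - k) / (m + 2)

end

/-! An intertwining operator is controlled by the components of its coefficients along the lowest
weight vector of `W₃`, i.e. by its coefficients modulo `upper`, the sum of the higher weight spaces.

By the commutator formula the span of all coefficients is an `𝔫𝔰(2)`-submodule of `W₃`. If it lies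
in `upper`, irreducibility makes it zero (`eq_zero_of_apply_mem_upper`). Elements of positive degree
map `W₃` into `upper`, so modulo `upper` the commutator formula moves such an element from the `W₂`
argument to the `W₁` argument. Hence it is enough to test on the lowest weight vector of `W₂`
(`apply_mem_upper_of_lowest`).

In the `W₁` argument, the Jacobi identity and the `L(-1)`-derivative property remove every element
of degree at least 2, leaving only products of `G⁺(-1/2)` and `G⁻(-1/2)`. These two square to zero
and anticommute up to `2L(-1)`, so four vectors remain: the lowest weight vector `w`, `G⁺(-1/2)w`,
`G⁻(-1/2)w` and `G⁺(-1/2)G⁻(-1/2)w` (`act_mem_lowestCore`). For each of them weights single out the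
one coefficient that can have a lowest component, which proves uniqueness.

The four vectors have `J(0)`-charges `q₁`, `q₁ + 1`, `q₁ - 1`, `q₁`. Charge conservation kills every
leading coefficient whose charge plus `q₂` is not `q₃`, and counting the survivors bounds the
dimension. The exponents of `𝒴` come from the `L(0)`-grading (`exists_exponent_bound`). -/

noncomputable section

/-! ### Brackets and degrees in the enveloping algebra -/

namespace NS2

/-- Twice the `L(0)`-weight by which a basis element raises. -/
def deg : NS2Gen → ℤ
  | .L n => -2 * n
  | .J n => -2 * n
  | .Gp k => -2 * k - 1
  | .Gm k => -2 * k - 1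
  | .C => 0

/-- The span of the basis elements of a given degree inside `U(𝔫𝔰(2))`. -/
def genSpan (d : ℤ) : Submodule ℂ U := Submodule.span ℂ (ι '' {g | deg g = d})

theorem ι_mem_genSpan {g : NS2Gen} {d : ℤ} (h : deg g = d) : ι g ∈ genSpan d :=
  Submodule.subset_span ⟨g, h, rfl⟩

/-- A central term occurs only in total degree 0, which is the degree of `C`, so brackets stay
homogeneous. -/
theorem delta_smul_C_mem_genSpan (n : ℤ) (a : ℂ) : (a * delta n) • ι .C ∈ genSpan (-2 * n) := by
  by_cases h : n = 0
  · exact Submodule.smul_mem _ _ (ι_mem_genSpan (by simp [deg, h]))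
  · simp [delta, h]

theorem L_bracket_L (m n : ℤ) : ι (.L m) * ι (.L n) - ι (.L n) * ι (.L m) =
    ((m : ℂ) - n) • ι (.L (m + n)) + (((m : ℂ) ^ 3 - m) / 12 * delta (m + n)) • ι .C := by
  simpa only [ι, map_sub, map_add, map_mul, map_smul, map_neg, map_zero] using
    RingQuot.mkAlgHom_rel ℂ (Rel.LL m n)

theorem J_bracket_J (m n : ℤ) : ι (.J m) * ι (.J n) - ι (.J n) * ι (.J m) =
    ((m : ℂ) / 3 * delta (m + n)) • ι .C := by
  simpa only [ι, map_sub, map_add, map_mul, map_smul, map_neg, map_zero] using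
    RingQuot.mkAlgHom_rel ℂ (Rel.JJ m n)

theorem L_bracket_J (m n : ℤ) : ι (.L m) * ι (.J n) - ι (.J n) * ι (.L m) =
    (-(n : ℂ)) • ι (.J (m + n)) := by
  simpa only [ι, map_sub, map_add, map_mul, map_smul, map_neg, map_zero] using
    RingQuot.mkAlgHom_rel ℂ (Rel.LJ m n)

theorem L_bracket_Gp (m k : ℤ) : ι (.L m) * ι (.Gp k) - ι (.Gp k) * ι (.L m) =
    ((m : ℂ) / 2 - (k + 1 / 2)) • ι (.Gp (m + k)) := by
  simpa only [ι, map_sub, map_add, map_mul, map_smul, map_neg, map_zero] using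
    RingQuot.mkAlgHom_rel ℂ (Rel.LGp m k)

theorem L_bracket_Gm (m k : ℤ) : ι (.L m) * ι (.Gm k) - ι (.Gm k) * ι (.L m) =
    ((m : ℂ) / 2 - (k + 1 / 2)) • ι (.Gm (m + k)) := by
  simpa only [ι, map_sub, map_add, map_mul, map_smul, map_neg, map_zero] using
    RingQuot.mkAlgHom_rel ℂ (Rel.LGm m k)

theorem J_bracket_Gp (m k : ℤ) : ι (.J m) * ι (.Gp k) - ι (.Gp k) * ι (.J m) =
    ι (.Gp (m + k)) := by
  simpa only [ι, map_sub, map_add, map_mul, map_smul, map_neg, map_zero] using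
    RingQuot.mkAlgHom_rel ℂ (Rel.JGp m k)

theorem J_bracket_Gm (m k : ℤ) : ι (.J m) * ι (.Gm k) - ι (.Gm k) * ι (.J m) =
    -ι (.Gm (m + k)) := by
  simpa only [ι, map_sub, map_add, map_mul, map_smul, map_neg, map_zero] using
    RingQuot.mkAlgHom_rel ℂ (Rel.JGm m k)

theorem Gp_bracket_Gm (k l : ℤ) : ι (.Gp k) * ι (.Gm l) + ι (.Gm l) * ι (.Gp k) =
    (2 : ℂ) • ι (.L (k + l + 1)) + ((k : ℂ) - l) • ι (.J (k + l + 1)) +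
      (((k + 1 / 2 : ℂ) ^ 2 - 1 / 4) / 3 * delta (k + l + 1)) • ι .C := by
  simpa only [ι, map_sub, map_add, map_mul, map_smul, map_neg, map_zero] using
    RingQuot.mkAlgHom_rel ℂ (Rel.GpGm k l)

theorem Gp_bracket_Gp (k l : ℤ) : ι (.Gp k) * ι (.Gp l) + ι (.Gp l) * ι (.Gp k) = 0 := by
  simpa only [ι, map_sub, map_add, map_mul, map_smul, map_neg, map_zero] using
    RingQuot.mkAlgHom_rel ℂ (Rel.GpGp k l)

theorem Gm_bracket_Gm (k l : ℤ) : ι (.Gm k) * ι (.Gm l) + ι (.Gm l) * ι (.Gm k) = 0 := by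
  simpa only [ι, map_sub, map_add, map_mul, map_smul, map_neg, map_zero] using
    RingQuot.mkAlgHom_rel ℂ (Rel.GmGm k l)

theorem C_central (g : NS2Gen) : ι .C * ι g = ι g * ι .C := by
  simpa only [ι, map_mul] using RingQuot.mkAlgHom_rel ℂ (Rel.central g)

/-- Two basis elements commute or anticommute up to basis elements of the total degree. -/
theorem exists_supercommute (g g' : NS2Gen) : ∃ e : ℂ, ∃ z ∈ genSpan (deg g + deg g'),
    ι g * ι g' = e • (ι g' * ι g) + z := by
  -- The scalar `e` is the sign of the superbracket. Leaving it existential lets commutators and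
  -- anticommutators be used uniformly.
  have comm : ∀ {a b z : U} {d : ℤ}, z ∈ genSpan d → a * b - b * a = z →
      ∃ e : ℂ, ∃ z ∈ genSpan d, a * b = e • (b * a) + z := fun {a b z d} hz h =>
    ⟨1, z, hz, by rw [← h]; module⟩
  have comm' : ∀ {a b z : U} {d : ℤ}, z ∈ genSpan d → b * a - a * b = z →
      ∃ e : ℂ, ∃ z ∈ genSpan d, a * b = e • (b * a) + z := fun {a b z d} hz h =>
    ⟨1, -z, neg_mem hz, by rw [← h]; module⟩
  have acomm : ∀ {a b z : U} {d : ℤ}, z ∈ genSpan d → a * b + b * a = z →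
      ∃ e : ℂ, ∃ z ∈ genSpan d, a * b = e • (b * a) + z := fun {a b z d} hz h =>
    ⟨-1, z, hz, by rw [← h]; module⟩
  have hC : ∀ {n d : ℤ} (a : ℂ), -2 * n = d → (a * delta n) • ι .C ∈ genSpan d :=
    fun a h => h ▸ delta_smul_C_mem_genSpan _ a
  have hg : ∀ {g : NS2Gen} {d : ℤ} (a : ℂ), deg g = d → a • ι g ∈ genSpan d :=
    fun a h => Submodule.smul_mem _ _ (ι_mem_genSpan h)
  have hGG : ∀ {k l d : ℤ} (a b e : ℂ), -2 * (k + l + 1) = d →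
      a • ι (.L (k + l + 1)) + b • ι (.J (k + l + 1)) + (e * delta (k + l + 1)) • ι .C ∈
        genSpan d := fun a b e h =>
    add_mem (add_mem (hg a (by simpa [deg] using h)) (hg b (by simpa [deg] using h))) (hC e h)
  cases g' with
  | C => exact comm' (zero_mem _) (sub_eq_zero.2 (C_central g))
  | L n =>
    cases g with
    | C => exact comm (zero_mem _) (sub_eq_zero.2 (C_central _))
    | L m =>
      exact comm (add_mem (hg _ (by simp only [deg]; ring)) (hC _ (by simp only [deg]; ring)))
        (L_bracket_L m n)
    | J m => exact comm' (hg _ (by simp only [deg]; ring)) (L_bracket_J n m)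
    | Gp m => exact comm' (hg _ (by simp only [deg]; ring)) (L_bracket_Gp n m)
    | Gm m => exact comm' (hg _ (by simp only [deg]; ring)) (L_bracket_Gm n m)
  | J n =>
    cases g with
    | C => exact comm (zero_mem _) (sub_eq_zero.2 (C_central _))
    | L m => exact comm (hg _ (by simp only [deg]; ring)) (L_bracket_J m n)
    | J m => exact comm (hC _ (by simp only [deg]; ring)) (J_bracket_J m n)
    | Gp m => exact comm' (ι_mem_genSpan (by simp only [deg]; ring)) (J_bracket_Gp n m)
    | Gm m => exact comm' (neg_mem (ι_mem_genSpan (by simp only [deg]; ring))) (J_bracket_Gm n m)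
  | Gp n =>
    cases g with
    | C => exact comm (zero_mem _) (sub_eq_zero.2 (C_central _))
    | L m => exact comm (hg _ (by simp only [deg]; ring)) (L_bracket_Gp m n)
    | J m => exact comm (ι_mem_genSpan (by simp only [deg]; ring)) (J_bracket_Gp m n)
    | Gp m => exact acomm (zero_mem _) (Gp_bracket_Gp m n)
    | Gm m =>
      exact acomm (hGG _ _ _ (by simp only [deg]; ring))
        ((add_comm _ _).trans (Gp_bracket_Gm n m))
  | Gm n =>
    cases g with
    | C => exact comm (zero_mem _) (sub_eq_zero.2 (C_central _))
    | L m => exact comm (hg _ (by simp only [deg]; ring)) (L_bracket_Gm m n)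
    | J m => exact comm (neg_mem (ι_mem_genSpan (by simp only [deg]; ring))) (J_bracket_Gm m n)
    | Gp m => exact acomm (hGG _ _ _ (by simp only [deg]; ring)) (Gp_bracket_Gm m n)
    | Gm m => exact acomm (zero_mem _) (Gm_bracket_Gm m n)

theorem L_zero_mul (g : NS2Gen) :
    ι (.L 0) * ι g = ι g * ι (.L 0) + ((deg g : ℂ) / 2) • ι g := by
  rw [← sub_eq_iff_eq_add']
  cases g with
  | C => rw [← C_central]; simp [deg]
  | L n => rw [L_bracket_L]; simp [deg, neg_div]
  | J n => rw [L_bracket_J]; simp [deg, neg_div]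
  | Gp n => rw [L_bracket_Gp, zero_add]; congr 1; simp only [deg]; push_cast; ring
  | Gm n => rw [L_bracket_Gm, zero_add]; congr 1; simp only [deg]; push_cast; ring

/-! ### Submodules and generation of `L(c, h, q)` -/

section Irr

variable {c h q : ℂ}

@[simp] theorem one_smul_irr (x : Irr c h q) : (1 : ℂ) • x = x := one_smul ℂ x

@[simp] theorem zero_smul_irr (x : Irr c h q) : (0 : ℂ) • x = 0 := zero_smul ℂ x

theorem smul_add_irr (a : ℂ) (x y : Irr c h q) : a • (x + y) = a • x + a • y := smul_add a x y

@[simp] theorem neg_smul_irr (a : ℂ) (x : Irr c h q) : (-a) • x = -(a • x) := neg_smul a x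

theorem act_apply (g : NS2Gen) (x : Irr c h q) : act g x = ι g • x := rfl

theorem smul_lowest_eq_zero {a : U} (ha : a ∈ vermaIdeal c h q) : a • lowest c h q = 0 := by
  have h1 : (vermaIdeal c h q).mkQ a = 0 := by simpa using ha
  rw [lowest, ← map_smul, ← map_smul, smul_eq_mul, mul_one, h1, map_zero]

theorem act_lowest_of_deg_neg {g : NS2Gen} (hg : deg g < 0) : act g (lowest c h q) = 0 := by
  refine smul_lowest_eq_zero (Submodule.subset_span (Or.inl ?_))
  cases g with
  | C => simp [deg] at hg
  | L n => exact Or.inl ⟨n, by simp only [deg] at hg; omega, Or.inl rfl⟩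
  | J n => exact Or.inl ⟨n, by simp only [deg] at hg; omega, Or.inr rfl⟩
  | Gp n => exact Or.inr ⟨n, by simp only [deg] at hg; omega, Or.inl rfl⟩
  | Gm n => exact Or.inr ⟨n, by simp only [deg] at hg; omega, Or.inr rfl⟩

theorem act_L_zero_lowest : act (.L 0) (lowest c h q) = h • lowest c h q := by
  have h1 := smul_lowest_eq_zero (c := c) (h := h) (q := q)
    (a := ι (.L 0) - algebraMap ℂ U h) (Submodule.subset_span (Or.inr (by simp)))
  rwa [sub_smul, algebraMap_smul, sub_eq_zero] at h1

theorem act_J_zero_lowest : act (.J 0) (lowest c h q) = q • lowest c h q := by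
  have h1 := smul_lowest_eq_zero (c := c) (h := h) (q := q)
    (a := ι (.J 0) - algebraMap ℂ U q) (Submodule.subset_span (Or.inr (by simp)))
  rwa [sub_smul, algebraMap_smul, sub_eq_zero] at h1

theorem act_C_lowest : act .C (lowest c h q) = c • lowest c h q := by
  have h1 := smul_lowest_eq_zero (c := c) (h := h) (q := q)
    (a := ι .C - algebraMap ℂ U c) (Submodule.subset_span (Or.inr (by simp)))
  rwa [sub_smul, algebraMap_smul, sub_eq_zero] at h1

theorem act_lowest_of_deg_nonpos {g : NS2Gen} (hg : deg g ≤ 0) :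
    ∃ a : ℂ, act g (lowest c h q) = a • lowest c h q := by
  rcases hg.lt_or_eq with hg | hg
  · exact ⟨0, by rw [act_lowest_of_deg_neg hg, zero_smul_irr]⟩
  · cases g with
    | C => exact ⟨_, act_C_lowest⟩
    | L n => obtain rfl : n = 0 := by simpa [deg] using hg
             exact ⟨_, act_L_zero_lowest⟩
    | J n => obtain rfl : n = 0 := by simpa [deg] using hg
             exact ⟨_, act_J_zero_lowest⟩
    | Gp n => simp only [deg] at hg; omega
    | Gm n => simp only [deg] at hg; omega

/-- A subspace stable under the basis elements of `𝔫𝔰(2)` is stable under `U(𝔫𝔰(2))`. -/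
theorem smul_mem_of_act_mem (K : Submodule ℂ (Irr c h q)) (hK : ∀ g, ∀ x ∈ K, act g x ∈ K)
    (a : U) : ∀ x ∈ K, a • x ∈ K := by
  obtain ⟨b, rfl⟩ := RingQuot.mkAlgHom_surjective ℂ Rel a
  induction b using FreeAlgebra.induction with
  | grade0 r => intro x hx; rw [AlgHom.commutes, algebraMap_smul]; exact K.smul_mem _ hx
  | grade1 g => exact hK g
  | mul a b ha hb => intro x hx; rw [map_mul, mul_smul]; exact ha _ (hb _ hx)
  | add a b ha hb => intro x hx; rw [map_add, add_smul]; exact K.add_mem (ha _ hx) (hb _ hx)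

theorem exists_smul_lowest (x : Irr c h q) : ∃ a : U, a • lowest c h q = x := by
  obtain ⟨y, rfl⟩ := (maxProper c h q).mkQ_surjective x
  obtain ⟨a, rfl⟩ := (vermaIdeal c h q).mkQ_surjective y
  exact ⟨a, by rw [lowest, ← map_smul, ← map_smul, smul_eq_mul, mul_one]⟩

/-- A submodule of `L(c, h, q)` that does not contain the lowest weight vector is zero. -/
theorem eq_bot_of_lowest_notMem (K : Submodule ℂ (Irr c h q))
    (hK : ∀ g, ∀ x ∈ K, act g x ∈ K) (hl : lowest c h q ∉ K) : K = ⊥ := by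
  let K' : Submodule U (Irr c h q) :=
    { K with smul_mem' := fun a x hx => smul_mem_of_act_mem K hK a x hx }
  -- The preimage of `K` in the Verma module misses the generator, so it is one of the proper
  -- submodules summed in `maxProper` and dies in the quotient.
  have hne : K'.comap (maxProper c h q).mkQ ≠ ⊤ := fun ht =>
    hl (show (vermaIdeal c h q).mkQ 1 ∈ K'.comap (maxProper c h q).mkQ by rw [ht]; trivial)
  have hle : K'.comap (maxProper c h q).mkQ ≤ maxProper c h q := le_sSup hne
  rw [eq_bot_iff]
  intro x hx
  obtain ⟨y, rfl⟩ := (maxProper c h q).mkQ_surjective x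
  have : y ∈ maxProper c h q := hle hx
  simpa using this

theorem smul_mem_of_mem_genSpan (K : Submodule ℂ (Irr c h q)) {d : ℤ} {x : Irr c h q}
    (hx : ∀ g, deg g = d → act g x ∈ K) {z : U} (hz : z ∈ genSpan d) : z • x ∈ K := by
  induction hz using Submodule.span_induction with
  | mem z hz => obtain ⟨g, hg, rfl⟩ := hz; exact hx g hg
  | zero => rw [zero_smul]; exact K.zero_mem
  | add a b _ _ ha hb => rw [add_smul]; exact K.add_mem ha hb
  | smul r a _ ha => rw [smul_assoc]; exact K.smul_mem r ha

/-- Reordering costs a sign, harmless for a subspace, and a combination of basis elements of the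
total degree, which `h2` controls. -/
theorem act_act_mem (K : Submodule ℂ (Irr c h q)) {g g' : NS2Gen} {x : Irr c h q}
    (h1 : act g' (act g x) ∈ K) (h2 : ∀ g'', deg g'' = deg g + deg g' → act g'' x ∈ K) :
    act g (act g' x) ∈ K := by
  obtain ⟨e, z, hz, he⟩ := exists_supercommute g g'
  rw [act_apply, act_apply, ← mul_smul, he, add_smul, smul_assoc, mul_smul]
  exact K.add_mem (K.smul_mem _ h1) (smul_mem_of_mem_genSpan K h2 hz)

/-- `L(c, h, q)` is generated from its lowest weight vector by the elements of positive degree. -/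
theorem eq_top_of_act_mem (K : Submodule ℂ (Irr c h q)) (hl : lowest c h q ∈ K)
    (hK : ∀ g, 0 < deg g → ∀ x ∈ K, act g x ∈ K) : K = ⊤ := by
  -- Instead of a PBW basis, take the least subspace `M` that contains the lowest weight vector and
  -- is stable under positive degrees. It suffices to show that `M` is stable under the remaining
  -- basis elements.
  let S : Set (Submodule ℂ (Irr c h q)) :=
    {M | lowest c h q ∈ M ∧ ∀ g, 0 < deg g → ∀ x ∈ M, act g x ∈ M}
  let M := sInf S
  have hMl : lowest c h q ∈ M := Submodule.mem_sInf.2 fun M' hM' => hM'.1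
  have hMp : ∀ g, 0 < deg g → ∀ x ∈ M, act g x ∈ M := fun g hg x hx =>
    Submodule.mem_sInf.2 fun M' hM' => hM'.2 g hg x (Submodule.mem_sInf.1 hx M' hM')
  let M' : Submodule ℂ (Irr c h q) := M ⊓ ⨅ g : {g // deg g ≤ 0}, M.comap (act g.1)
  have hM' : ∀ x, x ∈ M' ↔ x ∈ M ∧ ∀ g, deg g ≤ 0 → act g x ∈ M := fun x => by
    simp [M', Submodule.mem_iInf]
  -- The part `M'` of `M` sent into `M` by nonpositive degrees belongs to `S`: when `g'` is moved
  -- past `g`, the bracket terms have degree of either sign, and both signs preserve membership in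
  -- `M`. Minimality then gives `M ≤ M'`.
  have hle : M ≤ M' := by
    refine sInf_le ⟨(hM' _).2 ⟨hMl, fun g hg => ?_⟩, fun g hg x hx => ?_⟩
    · obtain ⟨a, ha⟩ := act_lowest_of_deg_nonpos (c := c) (h := h) (q := q) hg
      rw [ha]
      exact M.smul_mem _ hMl
    · obtain ⟨hx, hx'⟩ := (hM' x).1 hx
      refine (hM' _).2 ⟨hMp g hg x hx, fun g' hg' => ?_⟩
      refine act_act_mem M (hMp g hg _ (hx' g' hg')) fun g'' _ => ?_
      rcases lt_or_ge 0 (deg g'') with h | h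
      · exact hMp g'' h x hx
      · exact hx' g'' h
  have hMact : ∀ g, ∀ x ∈ M, act g x ∈ M := fun g x hx => by
    rcases lt_or_ge 0 (deg g) with h | h
    · exact hMp g h x hx
    · exact ((hM' x).1 (hle hx)).2 g h
  rw [eq_top_iff]
  intro x _
  obtain ⟨a, rfl⟩ := exists_smul_lowest x
  exact Submodule.mem_sInf.1 (smul_mem_of_act_mem M hMact a _ hMl) K ⟨hl, hK⟩

/-! ### Weights -/

/-- The weight space of weight `z`. -/
abbrev wt (c h q z : ℂ) : Submodule ℂ (Irr c h q) :=
  Module.End.eigenspace (act (.L 0)) z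

/-- The sum of the weight spaces of weights other than the lowest one. -/
def upper (c h q : ℂ) : Submodule ℂ (Irr c h q) := ⨆ n : ℕ, wt c h q (h + (n + 1) / 2)

theorem mem_wt {x : Irr c h q} {z : ℂ} : x ∈ wt c h q z ↔ act (.L 0) x = z • x :=
  Module.End.mem_eigenspace_iff

theorem lowest_mem_wt : lowest c h q ∈ wt c h q h := mem_wt.2 act_L_zero_lowest

theorem act_mem_wt (g : NS2Gen) {x : Irr c h q} {z : ℂ} (hx : x ∈ wt c h q z) :
    act g x ∈ wt c h q (z + deg g / 2) := by
  rw [mem_wt] at *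
  rw [act_apply, act_apply, ← mul_smul, L_zero_mul, add_smul, mul_smul, ← act_apply (.L 0), hx,
    smul_assoc, ← act_apply, map_smul, ← act_apply]
  module

theorem iSup_wt : ⨆ n : ℕ, wt c h q (h + n / 2) = ⊤ := by
  refine eq_top_of_act_mem _ ?_ fun g hg x hx => ?_
  · exact Submodule.mem_iSup_of_mem 0 (by simpa using lowest_mem_wt)
  · induction hx using Submodule.iSup_induction' with
    | mem n x hx =>
      obtain ⟨d, hd⟩ := Int.eq_ofNat_of_zero_le hg.le
      refine Submodule.mem_iSup_of_mem (n + d) ?_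
      have := act_mem_wt g hx
      rw [hd] at this
      convert this using 2
      push_cast
      ring
    | zero => rw [map_zero]; exact zero_mem _
    | add x y _ _ hx hy => rw [map_add]; exact add_mem hx hy

/-- All weights lie in `h + ½ℕ`, so raising the degree always leaves the weight `h` behind. -/
theorem act_mem_upper {g : NS2Gen} (hg : 0 < deg g) (x : Irr c h q) : act g x ∈ upper c h q := by
  have hx : x ∈ ⨆ n : ℕ, wt c h q (h + n / 2) := by rw [iSup_wt]; trivial
  induction hx using Submodule.iSup_induction' with
  | mem n x hx =>
    obtain ⟨d, hd⟩ := Int.eq_succ_of_zero_lt hg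
    refine Submodule.mem_iSup_of_mem (n + d) ?_
    have := act_mem_wt g hx
    rw [hd] at this
    convert this using 2
    push_cast
    ring
  | zero => rw [map_zero]; exact zero_mem _
  | add x y _ _ hx hy => rw [map_add]; exact add_mem hx hy

theorem exists_eq_smul_lowest_add (x : Irr c h q) :
    ∃ a : ℂ, ∃ y ∈ upper c h q, x = a • lowest c h q + y := by
  have : Submodule.span ℂ {lowest c h q} ⊔ upper c h q = ⊤ :=
    eq_top_of_act_mem _ (Submodule.mem_sup_left (Submodule.mem_span_singleton_self _))
      fun g hg x _ => Submodule.mem_sup_right (act_mem_upper hg x)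
  have hx : x ∈ Submodule.span ℂ {lowest c h q} ⊔ upper c h q := by rw [this]; trivial
  obtain ⟨y, hy, z, hz, rfl⟩ := Submodule.mem_sup.1 hx
  obtain ⟨a, rfl⟩ := Submodule.mem_span_singleton.1 hy
  exact ⟨a, z, hz, rfl⟩

theorem disjoint_wt_upper : Disjoint (wt c h q h) (upper c h q) := by
  have := Module.End.eigenspaces_iSupIndep (act (.L 0) : Module.End ℂ (Irr c h q)) h
  refine this.mono_right (iSup_le fun n => ?_)
  refine le_iSup₂_of_le (h + (n + 1) / 2) (fun h' => ?_) le_rfl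
  have h2 : ((n + 1 : ℕ) : ℂ) = 0 := by push_cast; linear_combination 2 * h'
  exact Nat.succ_ne_zero n (Nat.cast_eq_zero.1 h2)

/-- Subtracting the component along the lowest weight vector leaves a vector of weight `h` in
`upper`, which vanishes because eigenspaces are independent. -/
theorem mem_span_lowest {x : Irr c h q} (hx : x ∈ wt c h q h) :
    x ∈ Submodule.span ℂ {lowest c h q} := by
  obtain ⟨a, y, hy, rfl⟩ := exists_eq_smul_lowest_add x
  have hy' : y ∈ wt c h q h :=
    (Submodule.add_mem_iff_right _ (Submodule.smul_mem _ a lowest_mem_wt)).1 hx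
  rw [Submodule.disjoint_def.1 disjoint_wt_upper y hy' hy, add_zero]
  exact Submodule.smul_mem _ _ (Submodule.mem_span_singleton_self _)

/-- The eigenspaces of weights `h + n/2` already span the module, so independence leaves no room for
another eigenvalue. -/
theorem exists_nat_of_mem_wt {x : Irr c h q} {z : ℂ} (hx : x ∈ wt c h q z) (h0 : x ≠ 0) :
    ∃ n : ℕ, z = h + n / 2 := by
  by_contra! hne
  have := Module.End.eigenspaces_iSupIndep (act (.L 0) : Module.End ℂ (Irr c h q)) z
  have hle : (⊤ : Submodule ℂ (Irr c h q)) ≤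
      ⨆ (w) (_ : w ≠ z), Module.End.eigenspace (act (.L 0)) w := by
    rw [← iSup_wt]
    exact iSup_le fun n => le_iSup₂_of_le (h + n / 2) (hne n).symm le_rfl
  exact h0 (Submodule.disjoint_def.1 this x hx (hle trivial))

theorem mem_upper_of_mem_wt {x : Irr c h q} {z : ℂ} (hx : x ∈ wt c h q z) (hz : z ≠ h) :
    x ∈ upper c h q := by
  by_cases h0 : x = 0
  · rw [h0]; exact zero_mem _
  · obtain ⟨n, rfl⟩ := exists_nat_of_mem_wt hx h0
    cases n with
    | zero => simp at hz
    | succ n => exact Submodule.mem_iSup_of_mem n (by simpa using hx)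

/-- A submodule of `L(c, h, q)` inside the sum of the higher weight spaces is zero. -/
theorem eq_bot_of_le_upper (K : Submodule ℂ (Irr c h q))
    (hK : ∀ g, ∀ x ∈ K, act g x ∈ K) (hle : K ≤ upper c h q) : K = ⊥ := by
  by_cases hl : lowest c h q ∈ K
  · have h0 := Submodule.disjoint_def.1 disjoint_wt_upper _ lowest_mem_wt (hle hl)
    rw [eq_bot_iff]
    intro x _
    obtain ⟨a, rfl⟩ := exists_smul_lowest x
    rw [h0, smul_zero]
    exact zero_mem _
  · exact eq_bot_of_lowest_notMem K hK hl

/-- `C` is not a mode of any of the four generating fields, so the commutator formula does not cover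
it; being central, it acts by its value on the generator. -/
theorem act_C (x : Irr c h q) : act .C x = c • x := by
  have htop : Module.End.eigenspace (act .C : Module.End ℂ (Irr c h q)) c = ⊤ :=
    eq_top_of_act_mem _ (Module.End.mem_eigenspace_iff.2 act_C_lowest) fun g _ x hx => by
      rw [Module.End.mem_eigenspace_iff] at *
      rw [act_apply, act_apply, ← mul_smul, C_central, mul_smul, ← act_apply .C, hx,
        ← act_apply, map_smul, act_apply]
  exact Module.End.mem_eigenspace_iff.1 (by rw [htop]; trivial)

end Irr
end NS2

/-! ### Generating fields and their modes -/

namespace NS2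

/-- The modes `u_m` of the even or odd vector `u` of `L(c, 0, 0)` act on all modules `L(c, h, q)` as
the basis elements `g m`, of degree `s - 2 m`, of `𝔫𝔰(2)`. -/
structure IsGenField {c : ℂ} (A : IrrVOSA c) (u : Irr c 0 0) (i : ZMod 2) (s : ℤ)
    (g : ℤ → NS2Gen) : Prop where
  mem : u ∈ A.toVOSA.sign i
  deg_eq : ∀ m, deg (g m) = s - 2 * m
  mode : ∀ (h q : ℂ) (W : IrrModule A h q) (m : ℤ), vmode W.Y u m = act (g m)

section Fields

variable {c : ℂ} (A : IrrVOSA c)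

theorem isGenField_L : IsGenField A A.omega 0 2 (fun m => .L (m - 1)) where
  mem := Submodule.mem_iSup_of_mem 2 (by simpa using A.omega_weight)
  deg_eq m := by simp only [deg]; ring
  mode h q W m := by simpa using W.compatible.L (m - 1)

theorem isGenField_J : IsGenField A A.mu 0 0 .J where
  mem := A.mu_even
  deg_eq m := by simp only [deg]; ring
  mode h q W m := W.compatible.J m

theorem isGenField_Gp : IsGenField A A.taup 1 1 (fun m => .Gp (m - 1)) where
  mem := A.taup_odd
  deg_eq m := by simp only [deg]; ring
  mode h q W m := by simpa using W.compatible.Gp (m - 1)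

theorem isGenField_Gm : IsGenField A A.taum 1 1 (fun m => .Gm (m - 1)) where
  mem := A.taum_odd
  deg_eq m := by simp only [deg]; ring
  mode h q W m := by simpa using W.compatible.Gm (m - 1)

theorem exists_isGenField {g : NS2Gen} (hg : g ≠ .C) :
    ∃ u i s f m, IsGenField A u i s f ∧ f m = g := by
  cases g with
  | C => exact absurd rfl hg
  | L n => exact ⟨_, _, _, _, n + 1, isGenField_L A, by simp⟩
  | J n => exact ⟨_, _, _, _, n, isGenField_J A, rfl⟩
  | Gp n => exact ⟨_, _, _, _, n + 1, isGenField_Gp A, by simp⟩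
  | Gm n => exact ⟨_, _, _, _, n + 1, isGenField_Gm A, by simp⟩

end Fields

/-! ### Commutator formula, grading, and reduction to the lowest weight vector of `W₂` -/

section Intertwining

variable {c h₁ q₁ h₂ q₂ h₃ q₃ : ℂ} {A : IrrVOSA c} {W₁ : IrrModule A h₁ q₁}
  {W₂ : IrrModule A h₂ q₂} {W₃ : IrrModule A h₃ q₃}
  {I : ℂ → Irr c h₁ q₁ →ₗ[ℂ] Irr c h₂ q₂ →ₗ[ℂ] Irr c h₃ q₃}

theorem act_mem_sign (W : IrrModule A h₁ q₁) {u : Irr c 0 0} {i j : ZMod 2} {s : ℤ}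
    {g : ℤ → NS2Gen} (hu : IsGenField A u i s g) (m : ℤ) {w : Irr c h₁ q₁} (hw : w ∈ W.sign j) :
    act (g m) w ∈ W.sign (i + j) := by
  rw [← hu.mode h₁ q₁ W m]
  exact W.mode_sign i j u hu.mem w hw m

theorem lowest_mem_sign (W : IrrModule A h₁ q₁) : lowest c h₁ q₁ ∈ W.sign 0 := by
  rw [W.sign_eq]
  exact Submodule.mem_iSup_of_mem 0 (by simpa using lowest_mem_wt)

theorem exists_sign_add (W : IrrModule A h₁ q₁) (w : Irr c h₁ q₁) :
    ∃ w₀ ∈ W.sign 0, ∃ w₁ ∈ W.sign 1, w = w₀ + w₁ := by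
  obtain ⟨a, ha, b, hb, h⟩ := Submodule.mem_sup.1
    (show w ∈ W.sign 0 ⊔ W.sign 1 by rw [W.sign_isCompl.sup_eq_top]; trivial)
  exact ⟨a, ha, b, hb, h.symm⟩

theorem jacobi_act (hI : IsIntertwiningOperator W₁.toVOSAModule W₂.toVOSAModule W₃.toVOSAModule I)
    {u : Irr c 0 0} {i j : ZMod 2} {s : ℤ} {g : ℤ → NS2Gen} (hu : IsGenField A u i s g)
    {w : Irr c h₁ q₁} (hw : w ∈ W₁.sign j) (v : Irr c h₂ q₂) (l m : ℤ) (n : ℂ) :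
    ∀ᶠ T : ℕ in atTop,
      ∑ t ∈ Finset.range T, ((-1 : ℂ) ^ t * (Ring.choose l t : ℤ)) •
          (act (g (l + m - t)) (I (n + t) w v) -
            ((-1 : ℂ) ^ (i.val * j.val) * (-1 : ℂ) ^ l) •
              I (n + l - t) w (act (g (m + t)) v)) =
        ∑ t ∈ Finset.range T, ((Ring.choose m t : ℤ) : ℂ) •
          I (m + n - t) (act (g (l + t)) w) v := by
  have := hI.jacobi i j u hu.mem w hw v l m n
  simpa only [hu.mode] using this

/-- The commutator formula. -/
theorem exists_commutator
    (hI : IsIntertwiningOperator W₁.toVOSAModule W₂.toVOSAModule W₃.toVOSAModule I)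
    {u : Irr c 0 0} {i j : ZMod 2} {s : ℤ} {g : ℤ → NS2Gen} (hu : IsGenField A u i s g)
    {w : Irr c h₁ q₁} (hw : w ∈ W₁.sign j) (v : Irr c h₂ q₂) (m : ℤ) (n : ℂ) :
    ∃ T : ℕ, 2 ≤ T ∧ act (g m) (I n w v) - ((-1 : ℂ) ^ (i.val * j.val)) • I n w (act (g m) v) =
      ∑ t ∈ Finset.range T, ((Ring.choose m t : ℤ) : ℂ) • I (m + n - t) (act (g t) w) v := by
  obtain ⟨T, hT, hT2⟩ := ((jacobi_act hI hu hw v 0 m n).and (eventually_ge_atTop 2)).exists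
  refine ⟨T, hT2, ?_⟩
  -- For `l = 0` the binomial coefficients leave only the term `t = 0` on the left.
  rw [Finset.sum_eq_single 0] at hT
  · simpa using hT
  · intro t _ ht
    rw [Ring.choose_zero_pos _ (Nat.pos_of_ne_zero ht)]
    simp
  · intro h
    simp at h
    omega

/-- For `m = 0` the right side of the commutator formula also reduces to one term: `u_0` is a
superderivation of `𝒴`. -/
theorem commutator_zero
    (hI : IsIntertwiningOperator W₁.toVOSAModule W₂.toVOSAModule W₃.toVOSAModule I)
    {u : Irr c 0 0} {i j : ZMod 2} {s : ℤ} {g : ℤ → NS2Gen} (hu : IsGenField A u i s g)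
    {w : Irr c h₁ q₁} (hw : w ∈ W₁.sign j) (v : Irr c h₂ q₂) (n : ℂ) :
    act (g 0) (I n w v) - ((-1 : ℂ) ^ (i.val * j.val)) • I n w (act (g 0) v) =
      I n (act (g 0) w) v := by
  obtain ⟨T, hT2, hT⟩ := exists_commutator hI hu hw v 0 n
  rw [hT, Finset.sum_eq_single 0]
  · simp
  · intro t _ ht
    rw [Ring.choose_zero_pos _ (Nat.pos_of_ne_zero ht)]
    simp
  · intro h
    simp at h
    omega

theorem apply_act_L_neg_one
    (hI : IsIntertwiningOperator W₁.toVOSAModule W₂.toVOSAModule W₃.toVOSAModule I)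
    (w : Irr c h₁ q₁) (n : ℂ) : I n (act (.L (-1)) w) = (-n) • I (n - 1) w := by
  have := hI.derivative w n
  rwa [(isGenField_L A).mode] at this

theorem act_J_zero_apply
    (hI : IsIntertwiningOperator W₁.toVOSAModule W₂.toVOSAModule W₃.toVOSAModule I)
    (w : Irr c h₁ q₁) (v : Irr c h₂ q₂) (n : ℂ) :
    act (.J 0) (I n w v) = I n (act (.J 0) w) v + I n w (act (.J 0) v) := by
  have key : ∀ {j}, ∀ w ∈ W₁.sign j,
      act (.J 0) (I n w v) = I n (act (.J 0) w) v + I n w (act (.J 0) v) := fun {j} w hw => by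
    rw [← commutator_zero hI (isGenField_J A) hw v n]
    simp
  obtain ⟨a, ha, b, hb, rfl⟩ := exists_sign_add W₁ w
  simp only [map_add, LinearMap.add_apply, key a ha, key b hb]
  abel

theorem act_L_zero_apply
    (hI : IsIntertwiningOperator W₁.toVOSAModule W₂.toVOSAModule W₃.toVOSAModule I)
    (w : Irr c h₁ q₁) (v : Irr c h₂ q₂) (n : ℂ) :
    act (.L 0) (I n w v) =
      I n (act (.L 0) w) v + I n w (act (.L 0) v) - (n + 1) • I n w v := by
  have key : ∀ {j}, ∀ w ∈ W₁.sign j, act (.L 0) (I n w v) =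
      I n (act (.L 0) w) v + I n w (act (.L 0) v) - (n + 1) • I n w v := fun {j} w hw => by
    -- Here `L(0) = ω_1`, so only `t = 0` and `t = 1` contribute, with `L(-1)w` and `L(0)w`. The
    -- derivative property turns the former into `-(n + 1)` times the coefficient `I n w v`.
    obtain ⟨T, hT2, hT⟩ := exists_commutator hI (isGenField_L A) hw v 1 n
    obtain ⟨T, rfl⟩ := Nat.exists_eq_add_of_le' hT2
    rw [Finset.sum_range_succ', Finset.sum_range_succ', Finset.sum_eq_zero] at hT
    · have hd := apply_act_L_neg_one hI w (n + 1)
      simp only [add_sub_cancel_right] at hd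
      simp only [ZMod.val_zero, zero_mul, pow_zero, one_smul_irr, Int.cast_one, sub_self, zero_add,
        Nat.cast_zero, Nat.cast_one, Ring.choose_zero_right, Ring.choose_one_right,
        sub_zero, zero_sub, sub_eq_iff_eq_add] at hT
      rw [add_sub_cancel_left, add_comm 1 n, hd] at hT
      rw [hT, LinearMap.smul_apply]
      module
    · intro t _
      have h1 : Ring.choose (1 : ℤ) (t + 1 + 1) = 0 := by
        have := Ring.choose_natCast (R := ℤ) 1 (t + 1 + 1)
        rw [Nat.choose_eq_zero_of_lt (by omega)] at this
        simpa using this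
      rw [h1]
      simp
  obtain ⟨a, ha, b, hb, rfl⟩ := exists_sign_add W₁ w
  simp only [map_add, LinearMap.add_apply, key a ha, key b hb, smul_add_irr]
  abel

theorem apply_mem_wt
    (hI : IsIntertwiningOperator W₁.toVOSAModule W₂.toVOSAModule W₃.toVOSAModule I)
    {w : Irr c h₁ q₁} {v : Irr c h₂ q₂} {a b : ℂ} (hw : w ∈ wt c h₁ q₁ a)
    (hv : v ∈ wt c h₂ q₂ b) (n : ℂ) : I n w v ∈ wt c h₃ q₃ (a + b - n - 1) := by
  rw [mem_wt] at *
  rw [act_L_zero_apply hI, hw, hv, map_smul, map_smul, LinearMap.smul_apply]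
  module

/-- The exponents of `𝒴(w, x)v` lie in `Δ + ½ℤ` and are bounded below. -/
theorem exists_exponent_bound
    (hI : IsIntertwiningOperator W₁.toVOSAModule W₂.toVOSAModule W₃.toVOSAModule I)
    (w : Irr c h₁ q₁) (v : Irr c h₂ q₂) : ∃ N : ℤ, ∀ n : ℂ, I n w v ≠ 0 →
      ∃ p : ℤ, N ≤ p ∧ -n - 1 = h₃ - h₁ - h₂ + p / 2 := by
  have hw : w ∈ ⨆ n : ℕ, wt c h₁ q₁ (h₁ + n / 2) := by rw [iSup_wt]; trivial
  have hv : v ∈ ⨆ n : ℕ, wt c h₂ q₂ (h₂ + n / 2) := by rw [iSup_wt]; trivial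
  have hadd : ∀ {f g k : ℂ → Irr c h₃ q₃}, (∀ n, k n = f n + g n) →
      (∃ N : ℤ, ∀ n : ℂ, f n ≠ 0 → ∃ p : ℤ, N ≤ p ∧ -n - 1 = h₃ - h₁ - h₂ + p / 2) →
      (∃ N : ℤ, ∀ n : ℂ, g n ≠ 0 → ∃ p : ℤ, N ≤ p ∧ -n - 1 = h₃ - h₁ - h₂ + p / 2) →
      ∃ N : ℤ, ∀ n : ℂ, k n ≠ 0 → ∃ p : ℤ, N ≤ p ∧ -n - 1 = h₃ - h₁ - h₂ + p / 2 := by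
    rintro f g k hk ⟨N, hN⟩ ⟨N', hN'⟩
    refine ⟨min N N', fun n hn => ?_⟩
    rw [hk] at hn
    by_cases hf : f n = 0
    · rw [hf, zero_add] at hn
      obtain ⟨p, hp, h⟩ := hN' n hn
      exact ⟨p, (min_le_right _ _).trans hp, h⟩
    · obtain ⟨p, hp, h⟩ := hN n hf
      exact ⟨p, (min_le_left _ _).trans hp, h⟩
  induction hw using Submodule.iSup_induction' with
  | zero => exact ⟨0, fun n hn => by simp at hn⟩
  | add x y _ _ hx hy => exact hadd (fun n => by simp) hx hy
  | mem i w hw =>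
    induction hv using Submodule.iSup_induction' with
    | zero => exact ⟨0, fun n hn => by simp at hn⟩
    | add x y _ _ hx hy => exact hadd (fun n => by simp) hx hy
    | mem j v hv =>
      -- The weight of a nonzero coefficient is `h₃ + p/2` with `p ≥ 0`. Comparison with the weights
      -- of `w` and `v` gives the exponent `Δ + (p - i - j)/2`.
      refine ⟨-i - j, fun n hn => ?_⟩
      obtain ⟨p, hp⟩ := exists_nat_of_mem_wt (apply_mem_wt hI hw hv n) hn
      refine ⟨p - i - j, by omega, ?_⟩
      push_cast
      linear_combination hp

/-- An intertwining operator is zero if all its coefficients lie in the higher weight spaces. -/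
theorem eq_zero_of_apply_mem_upper
    (hI : IsIntertwiningOperator W₁.toVOSAModule W₂.toVOSAModule W₃.toVOSAModule I)
    (h : ∀ n w v, I n w v ∈ upper c h₃ q₃) : I = 0 := by
  -- The commutator formula writes `g` applied to a coefficient as a combination of coefficients, so
  -- their span is a submodule.
  let K : Submodule ℂ (Irr c h₃ q₃) := Submodule.span ℂ {x | ∃ n w v, I n w v = x}
  have hmem : ∀ n w v, I n w v ∈ K := fun n w v => Submodule.subset_span ⟨n, w, v, rfl⟩
  have hK : ∀ g, ∀ x ∈ K, act g x ∈ K := by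
    intro g x hx
    by_cases hg : g = .C
    · rw [hg, act_C]
      exact K.smul_mem _ hx
    obtain ⟨u, i, s, f, m, hu, rfl⟩ := exists_isGenField A hg
    induction hx using Submodule.span_induction with
    | zero => rw [map_zero]; exact K.zero_mem
    | add x y _ _ hx hy => rw [map_add]; exact K.add_mem hx hy
    | smul r x _ hx => rw [map_smul]; exact K.smul_mem r hx
    | mem x hx =>
      obtain ⟨n, w, v, rfl⟩ := hx
      have key : ∀ {j}, ∀ w ∈ W₁.sign j, act (f m) (I n w v) ∈ K := fun {j} w hw => by
        obtain ⟨T, -, hT⟩ := exists_commutator hI hu hw v m n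
        rw [sub_eq_iff_eq_add] at hT
        rw [hT]
        exact K.add_mem (K.sum_mem fun t _ => K.smul_mem _ (hmem _ _ _)) (K.smul_mem _ (hmem _ _ _))
      obtain ⟨a, ha, b, hb, rfl⟩ := exists_sign_add W₁ w
      rw [map_add, LinearMap.add_apply, map_add]
      exact K.add_mem (key a ha) (key b hb)
  have hbot := eq_bot_of_le_upper K hK
    (Submodule.span_le.2 (by rintro _ ⟨n, w, v, rfl⟩; exact h n w v))
  refine funext fun n => LinearMap.ext fun w => LinearMap.ext fun v => ?_
  have := hmem n w v
  rwa [hbot, Submodule.mem_bot] at this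

/-- The coefficients of an intertwining operator lie in the higher weight spaces if those on the
lowest weight vector do. -/
theorem apply_mem_upper_of_lowest
    (hI : IsIntertwiningOperator W₁.toVOSAModule W₂.toVOSAModule W₃.toVOSAModule I)
    (h : ∀ n w, I n w (lowest c h₂ q₂) ∈ upper c h₃ q₃) (n : ℂ) (w : Irr c h₁ q₁)
    (v : Irr c h₂ q₂) : I n w v ∈ upper c h₃ q₃ := by
  let K : Submodule ℂ (Irr c h₂ q₂) := ⨅ (n : ℂ) (w : Irr c h₁ q₁), (upper c h₃ q₃).comap (I n w)
  have hK : ∀ v, v ∈ K ↔ ∀ n w, I n w v ∈ upper c h₃ q₃ := fun v => by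
    simp [K, Submodule.mem_iInf]
  have htop : K = ⊤ := by
    refine eq_top_of_act_mem K ((hK _).2 h) fun g hg v hv => (hK _).2 fun n w => ?_
    obtain ⟨u, i, s, f, m, hu, rfl⟩ :=
      exists_isGenField A (g := g) (by rintro rfl; simp [deg] at hg)
    have key : ∀ {j}, ∀ w ∈ W₁.sign j, I n w (act (f m) v) ∈ upper c h₃ q₃ := fun {j} w hw => by
      obtain ⟨T, -, hT⟩ := exists_commutator hI hu hw v m n
      -- Solve the commutator formula for the term with `g` on `v`: the outer action of `g` lands in
      -- `upper`, and every other term has `v` itself as argument.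
      have hmem : ((-1 : ℂ) ^ (i.val * j.val)) • I n w (act (f m) v) ∈ upper c h₃ q₃ := by
        rw [sub_eq_iff_eq_add, ← sub_eq_iff_eq_add'] at hT
        rw [← hT]
        exact sub_mem (act_mem_upper hg _)
          (Submodule.sum_mem _ fun t _ => Submodule.smul_mem _ _ ((hK v).1 hv _ _))
      rcases neg_one_pow_eq_or ℂ (i.val * j.val) with h | h
      · simpa [h] using hmem
      · simpa [h] using hmem
    obtain ⟨a, ha, b, hb, rfl⟩ := exists_sign_add W₁ w
    rw [map_add, LinearMap.add_apply]
    exact add_mem (key a ha) (key b hb)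
  exact (hK v).1 (by rw [htop]; trivial) n w

end Intertwining
end NS2

/-! ### Reduction to four leading coefficients -/

namespace NS2

section LowestPart

variable {c h₁ q₁ h₂ q₂ h₃ q₃ : ℂ} {A : IrrVOSA c} {W₁ : IrrModule A h₁ q₁}
  {W₂ : IrrModule A h₂ q₂} {W₃ : IrrModule A h₃ q₃}
  {I : ℂ → Irr c h₁ q₁ →ₗ[ℂ] Irr c h₂ q₂ →ₗ[ℂ] Irr c h₃ q₃}

/-- The vectors `w` for which no coefficient of `𝒴(w, x)𝟏_{c,h₂,q₂}` has a component along
`𝟏_{c,h₃,q₃}`. -/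
def lowestKer (I : ℂ → Irr c h₁ q₁ →ₗ[ℂ] Irr c h₂ q₂ →ₗ[ℂ] Irr c h₃ q₃) :
    Submodule ℂ (Irr c h₁ q₁) :=
  ⨅ n, (upper c h₃ q₃).comap ((I n).flip (lowest c h₂ q₂))

theorem mem_lowestKer {w : Irr c h₁ q₁} :
    w ∈ lowestKer I ↔ ∀ n, I n w (lowest c h₂ q₂) ∈ upper c h₃ q₃ := by
  simp [lowestKer, Submodule.mem_iInf]

/-- The Jacobi identity with `m = 0` expresses `𝒴(u_l w, x)` through modes `u_{l-t}` acting outside,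
which raise degree, and modes `u_t` with `t ≥ 0` acting on the lowest weight vector. The latter act
by scalars unless `t = 0` and `s > 0`, the case covered by `h0`. -/
theorem act_mem_lowestKer_of_field
    (hI : IsIntertwiningOperator W₁.toVOSAModule W₂.toVOSAModule W₃.toVOSAModule I)
    {u : Irr c 0 0} {i j : ZMod 2} {s : ℤ} {g : ℤ → NS2Gen} (hu : IsGenField A u i s g)
    (hs : 0 ≤ s) (hs' : s ≤ 2) {w : Irr c h₁ q₁} (hw : w ∈ W₁.sign j) (hQ : w ∈ lowestKer I)
    (h0 : 0 < s → act (g 0) w ∈ lowestKer I) {l : ℤ} (hl : l < 0) :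
    act (g l) w ∈ lowestKer I := by
  rw [mem_lowestKer] at hQ ⊢
  have hpos : ∀ (t : ℕ) (n : ℂ), I n w (act (g t) (lowest c h₂ q₂)) ∈ upper c h₃ q₃ := by
    intro t n
    have hd := hu.deg_eq t
    rcases le_or_gt (deg (g t)) 0 with hg | hg
    · obtain ⟨a, ha⟩ := act_lowest_of_deg_nonpos (c := c) (h := h₂) (q := q₂) hg
      rw [ha, map_smul]
      exact Submodule.smul_mem _ _ (hQ n)
    -- Since `s ≤ 2`, only `u_0` can have positive degree. Modulo `upper` its action on the lowest
    -- weight vector is traded for its action on `w`.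
    · obtain rfl : t = 0 := by omega
      have h1 := commutator_zero hI hu hw (lowest c h₂ q₂) n
      have hmem : ((-1 : ℂ) ^ (i.val * j.val)) • I n w (act (g 0) (lowest c h₂ q₂)) ∈
          upper c h₃ q₃ := by
        rw [sub_eq_iff_eq_add, ← sub_eq_iff_eq_add'] at h1
        rw [← h1]
        exact sub_mem (act_mem_upper hg _) (mem_lowestKer.1 (h0 (by omega)) n)
      rcases neg_one_pow_eq_or ℂ (i.val * j.val) with h | h
      · simpa [h] using hmem
      · simpa [h] using hmem
  intro n
  obtain ⟨T, hT, hT1⟩ := ((jacobi_act hI hu hw (lowest c h₂ q₂) l 0 n).and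
    (eventually_ge_atTop 1)).exists
  rw [Finset.sum_eq_single (s := Finset.range T) (a := 0)
    (f := fun t : ℕ => ((Ring.choose (0 : ℤ) t : ℤ) : ℂ) • _)] at hT
  · simp only [Ring.choose_zero_right, Int.cast_one, one_smul_irr, Int.cast_zero, zero_add,
      Nat.cast_zero, sub_zero, add_zero] at hT
    rw [← hT]
    refine Submodule.sum_mem _ fun t _ => Submodule.smul_mem _ _ (sub_mem (act_mem_upper ?_ _)
      (Submodule.smul_mem _ _ (hpos t _)))
    rw [hu.deg_eq]
    omega
  · intro t _ ht
    rw [Ring.choose_zero_pos _ (Nat.pos_of_ne_zero ht)]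
    simp
  · intro h
    simp at h
    omega

theorem act_L_neg_one_mem_lowestKer
    (hI : IsIntertwiningOperator W₁.toVOSAModule W₂.toVOSAModule W₃.toVOSAModule I)
    {w : Irr c h₁ q₁} (hw : w ∈ lowestKer I) : act (.L (-1)) w ∈ lowestKer I := by
  rw [mem_lowestKer] at *
  intro n
  rw [apply_act_L_neg_one hI, LinearMap.smul_apply]
  exact Submodule.smul_mem _ _ (hw _)

/-- The hypothesis on `u_0 w` is supplied by the derivative property for `ω` and by `hp`, `hm` for
`τ^±`; none is needed for `μ`. The bound `2 ≤ deg g` leaves out just `G^±(-1/2)` among positive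
degrees. -/
theorem act_mem_lowestKer
    (hI : IsIntertwiningOperator W₁.toVOSAModule W₂.toVOSAModule W₃.toVOSAModule I)
    {j : ZMod 2} {w : Irr c h₁ q₁} (hw : w ∈ W₁.sign j) (hQ : w ∈ lowestKer I)
    (hp : act (.Gp (-1)) w ∈ lowestKer I) (hm : act (.Gm (-1)) w ∈ lowestKer I)
    {g : NS2Gen} (hg : 2 ≤ deg g) : act g w ∈ lowestKer I := by
  cases g with
  | C => simp [deg] at hg
  | L n =>
    simp only [deg] at hg
    by_cases hn : n = -1
    · rw [hn]
      exact act_L_neg_one_mem_lowestKer hI hQ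
    · have := act_mem_lowestKer_of_field hI (isGenField_L A) (by norm_num) (by norm_num) hw hQ
        (fun _ => act_L_neg_one_mem_lowestKer hI hQ) (l := n + 1) (by omega)
      rwa [add_sub_cancel_right] at this
  | J n =>
    simp only [deg] at hg
    exact act_mem_lowestKer_of_field hI (isGenField_J A) (by norm_num) (by norm_num) hw hQ
      (fun h => absurd h (by norm_num)) (by omega)
  | Gp n =>
    simp only [deg] at hg
    have := act_mem_lowestKer_of_field hI (isGenField_Gp A) (by norm_num) (by norm_num) hw hQ
      (fun _ => hp) (l := n + 1) (by omega)
    rwa [add_sub_cancel_right] at this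
  | Gm n =>
    simp only [deg] at hg
    have := act_mem_lowestKer_of_field hI (isGenField_Gm A) (by norm_num) (by norm_num) hw hQ
      (fun _ => hm) (l := n + 1) (by omega)
    rwa [add_sub_cancel_right] at this

theorem act_Gp_act_Gp (w : Irr c h₁ q₁) : act (.Gp (-1)) (act (.Gp (-1)) w) = 0 := by
  have h := congrArg ((2⁻¹ : ℂ) • ·) (Gp_bracket_Gp (-1) (-1))
  have h' : ι (.Gp (-1)) * ι (.Gp (-1)) = 0 := by
    rw [← smul_zero (2⁻¹ : ℂ), ← h]; module
  rw [act_apply, act_apply, ← mul_smul, h', zero_smul]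

theorem act_Gm_act_Gm (w : Irr c h₁ q₁) : act (.Gm (-1)) (act (.Gm (-1)) w) = 0 := by
  have h := congrArg ((2⁻¹ : ℂ) • ·) (Gm_bracket_Gm (-1) (-1))
  have h' : ι (.Gm (-1)) * ι (.Gm (-1)) = 0 := by
    rw [← smul_zero (2⁻¹ : ℂ), ← h]; module
  rw [act_apply, act_apply, ← mul_smul, h', zero_smul]

theorem act_Gm_act_Gp (w : Irr c h₁ q₁) : act (.Gm (-1)) (act (.Gp (-1)) w) =
    (2 : ℂ) • act (.L (-1)) w - act (.Gp (-1)) (act (.Gm (-1)) w) := by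
  have h : ι (.Gm (-1)) * ι (.Gp (-1)) =
      (2 : ℂ) • ι (.L (-1)) - ι (.Gp (-1)) * ι (.Gm (-1)) := by
    rw [eq_sub_iff_add_eq', Gp_bracket_Gm]
    simp [delta]
  rw [act_apply, act_apply, ← mul_smul, h, sub_smul, smul_assoc, mul_smul]
  rfl

theorem act_Gp_act_L (w : Irr c h₁ q₁) :
    act (.Gp (-1)) (act (.L (-1)) w) = act (.L (-1)) (act (.Gp (-1)) w) := by
  have h : ι (.Gp (-1)) * ι (.L (-1)) = ι (.L (-1)) * ι (.Gp (-1)) := by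
    rw [eq_comm, ← sub_eq_zero, L_bracket_Gp]
    convert zero_smul ℂ _ using 2
    norm_num
  rw [act_apply, act_apply, ← mul_smul, h, mul_smul]
  rfl

/-- The homogeneous vectors of sign `j` whose products with the exterior algebra on `G^±(-1/2)` lie
in `lowestKer I`. -/
def lowestCore (W₁ : IrrModule A h₁ q₁)
    (I : ℂ → Irr c h₁ q₁ →ₗ[ℂ] Irr c h₂ q₂ →ₗ[ℂ] Irr c h₃ q₃) (j : ZMod 2) :
    Set (Irr c h₁ q₁) :=
  {w | w ∈ W₁.sign j ∧ w ∈ lowestKer I ∧ act (.Gp (-1)) w ∈ lowestKer I ∧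
    act (.Gm (-1)) w ∈ lowestKer I ∧ act (.Gp (-1)) (act (.Gm (-1)) w) ∈ lowestKer I}

/-- Only the order `G⁺G⁻` is part of the core; the opposite order differs by `2L(-1)`, which
preserves `lowestKer I` and commutes with `G⁺(-1/2)`. -/
theorem act_Gp_mem_lowestCore
    (hI : IsIntertwiningOperator W₁.toVOSAModule W₂.toVOSAModule W₃.toVOSAModule I)
    {j : ZMod 2} {w : Irr c h₁ q₁} (hw : w ∈ lowestCore W₁ I j) :
    act (.Gp (-1)) w ∈ lowestCore W₁ I (1 + j) := by
  obtain ⟨hs, h0, hp, hm, hpm⟩ := hw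
  refine ⟨act_mem_sign W₁ (isGenField_Gp A) 0 hs, hp, ?_, ?_, ?_⟩
  · rw [act_Gp_act_Gp]
    exact zero_mem _
  · rw [act_Gm_act_Gp]
    exact sub_mem (Submodule.smul_mem _ _ (act_L_neg_one_mem_lowestKer hI h0)) hpm
  · rw [act_Gm_act_Gp, map_sub, map_smul, act_Gp_act_Gp, act_Gp_act_L, sub_zero]
    exact Submodule.smul_mem _ _ (act_L_neg_one_mem_lowestKer hI hp)

theorem act_Gm_mem_lowestCore {j : ZMod 2} {w : Irr c h₁ q₁} (hw : w ∈ lowestCore W₁ I j) :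
    act (.Gm (-1)) w ∈ lowestCore W₁ I (1 + j) := by
  obtain ⟨hs, h0, hp, hm, hpm⟩ := hw
  refine ⟨act_mem_sign W₁ (isGenField_Gm A) 0 hs, hm, hpm, ?_, ?_⟩
  · rw [act_Gm_act_Gm]
    exact zero_mem _
  · rw [act_Gm_act_Gm, map_zero]
    exact zero_mem _

/-- For degree at least 2, `G^±(-1/2)` is moved to the right past `g`. The bracket terms again have
degree at least 2, so `act_mem_lowestKer` applies to them and to the reordered product. -/
theorem act_mem_lowestCore
    (hI : IsIntertwiningOperator W₁.toVOSAModule W₂.toVOSAModule W₃.toVOSAModule I)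
    {j : ZMod 2} {w : Irr c h₁ q₁} (hw : w ∈ lowestCore W₁ I j) {g : NS2Gen} (hg : 0 < deg g) :
    ∃ j', act g w ∈ lowestCore W₁ I j' := by
  have hGp : deg (.Gp (-1)) = 1 := rfl
  have hGm : deg (.Gm (-1)) = 1 := rfl
  have deep : ∀ {j w g}, w ∈ lowestCore W₁ I j → 2 ≤ deg g → act g w ∈ lowestKer I :=
    fun hw hg => act_mem_lowestKer hI hw.1 hw.2.1 hw.2.2.1 hw.2.2.2.1 hg
  have deepp : ∀ {j w g}, w ∈ lowestCore W₁ I j → 2 ≤ deg g →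
      act (.Gp (-1)) (act g w) ∈ lowestKer I := fun hw hg =>
    act_act_mem _ (deep (act_Gp_mem_lowestCore hI hw) hg) fun g' hg' =>
      deep hw (by omega)
  have deepm : ∀ {j w g}, w ∈ lowestCore W₁ I j → 2 ≤ deg g →
      act (.Gm (-1)) (act g w) ∈ lowestKer I := fun hw hg =>
    act_act_mem _ (deep (act_Gm_mem_lowestCore hw) hg) fun g' hg' =>
      deep hw (by omega)
  -- Only `G⁻(-1/2)` and `g` are exchanged; the outer `G⁺(-1/2)` is absorbed into the target
  -- subspace by `comap`.
  have deeppm : ∀ {j w g}, w ∈ lowestCore W₁ I j → 2 ≤ deg g →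
      act (.Gp (-1)) (act (.Gm (-1)) (act g w)) ∈ lowestKer I := fun hw hg =>
    act_act_mem ((lowestKer I).comap (act (.Gp (-1)))) (deepp (act_Gm_mem_lowestCore hw) hg)
      fun g' hg' => deepp hw (by omega)
  rcases (show deg g = 1 ∨ 2 ≤ deg g by omega) with h1 | h2
  · cases g with
    | C => simp [deg] at h1
    | L n => simp only [deg] at h1; omega
    | J n => simp only [deg] at h1; omega
    | Gp n =>
      obtain rfl : n = -1 := by simp only [deg] at h1; omega
      exact ⟨_, act_Gp_mem_lowestCore hI hw⟩
    | Gm n =>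
      obtain rfl : n = -1 := by simp only [deg] at h1; omega
      exact ⟨_, act_Gm_mem_lowestCore hw⟩
  · obtain ⟨u, i, s, f, m, hu, rfl⟩ :=
      exists_isGenField A (g := g) (by rintro rfl; simp [deg] at hg)
    exact ⟨_, act_mem_sign W₁ hu m hw.1, deep hw h2, deepp hw h2, deepm hw h2, deeppm hw h2⟩

/-- An intertwining operator is zero if its four leading coefficients vanish. -/
theorem eq_zero_of_lowest_mem_upper
    (hI : IsIntertwiningOperator W₁.toVOSAModule W₂.toVOSAModule W₃.toVOSAModule I)
    (h : lowest c h₁ q₁ ∈ lowestCore W₁ I 0) : I = 0 := by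
  refine eq_zero_of_apply_mem_upper hI (apply_mem_upper_of_lowest hI fun n w => ?_)
  -- The core consists of vectors of a fixed sign, so it is the span over both signs that is stable
  -- under positive degrees.
  have htop : Submodule.span ℂ {w | ∃ j, w ∈ lowestCore W₁ I j} = ⊤ := by
    refine eq_top_of_act_mem _ (Submodule.subset_span ⟨0, h⟩) fun g hg x hx => ?_
    induction hx using Submodule.span_induction with
    | mem x hx =>
      obtain ⟨j, hj⟩ := hx
      exact Submodule.subset_span (act_mem_lowestCore hI hj hg)
    | zero => rw [map_zero]; exact zero_mem _
    | add x y _ _ hx hy => rw [map_add]; exact add_mem hx hy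
    | smul r x _ hx => rw [map_smul]; exact Submodule.smul_mem _ r hx
  have hle : Submodule.span ℂ {w | ∃ j, w ∈ lowestCore W₁ I j} ≤ lowestKer I :=
    Submodule.span_le.2 fun x ⟨_, hx⟩ => hx.2.1
  exact mem_lowestKer.1 (hle (by rw [htop]; trivial)) n

/-- For `w` of weight `a`, only this index `n` yields weight `h₃`; every other coefficient is in
`upper` by its weight. -/
theorem mem_lowestKer_of_apply_eq_zero
    (hI : IsIntertwiningOperator W₁.toVOSAModule W₂.toVOSAModule W₃.toVOSAModule I)
    {w : Irr c h₁ q₁} {a n : ℂ} (hw : w ∈ wt c h₁ q₁ a) (hn : n = a + h₂ - h₃ - 1)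
    (h0 : I n w (lowest c h₂ q₂) = 0) : w ∈ lowestKer I := by
  refine mem_lowestKer.2 fun n' => ?_
  by_cases hn' : n' = n
  · rw [hn', h0]
    exact zero_mem _
  · refine mem_upper_of_mem_wt (apply_mem_wt hI hw lowest_mem_wt n') fun h => hn' ?_
    rw [hn]
    linear_combination -h

theorem act_Gp_lowest_mem_wt : act (.Gp (-1)) (lowest c h₁ q₁) ∈ wt c h₁ q₁ (h₁ + 1 / 2) := by
  have := act_mem_wt (.Gp (-1)) (lowest_mem_wt (c := c) (h := h₁) (q := q₁))
  simpa [deg] using this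

theorem act_Gm_lowest_mem_wt : act (.Gm (-1)) (lowest c h₁ q₁) ∈ wt c h₁ q₁ (h₁ + 1 / 2) := by
  have := act_mem_wt (.Gm (-1)) (lowest_mem_wt (c := c) (h := h₁) (q := q₁))
  simpa [deg] using this

theorem act_Gp_act_Gm_lowest_mem_wt :
    act (.Gp (-1)) (act (.Gm (-1)) (lowest c h₁ q₁)) ∈ wt c h₁ q₁ (h₁ + 1) := by
  have := act_mem_wt (.Gp (-1)) (act_Gm_lowest_mem_wt (c := c) (h₁ := h₁) (q₁ := q₁))
  convert this using 1
  simp only [deg]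
  push_cast
  congr 1
  ring

theorem eq_zero_of_leading_coeff_eq_zero
    (hI : IsIntertwiningOperator W₁.toVOSAModule W₂.toVOSAModule W₃.toVOSAModule I)
    (h0 : I (-(h₃ - h₁ - h₂) - 1) (lowest c h₁ q₁) (lowest c h₂ q₂) = 0)
    (hp : I (-(h₃ - h₁ - h₂) - 1 / 2) (act (.Gp (-1)) (lowest c h₁ q₁)) (lowest c h₂ q₂) = 0)
    (hm : I (-(h₃ - h₁ - h₂) - 1 / 2) (act (.Gm (-1)) (lowest c h₁ q₁)) (lowest c h₂ q₂) = 0)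
    (hpm : I (-(h₃ - h₁ - h₂)) (act (.Gp (-1)) (act (.Gm (-1)) (lowest c h₁ q₁)))
      (lowest c h₂ q₂) = 0) : I = 0 :=
  eq_zero_of_lowest_mem_upper hI ⟨lowest_mem_sign W₁,
    mem_lowestKer_of_apply_eq_zero hI lowest_mem_wt (by ring) h0,
    mem_lowestKer_of_apply_eq_zero hI act_Gp_lowest_mem_wt (by ring) hp,
    mem_lowestKer_of_apply_eq_zero hI act_Gm_lowest_mem_wt (by ring) hm,
    mem_lowestKer_of_apply_eq_zero hI act_Gp_act_Gm_lowest_mem_wt (by ring) hpm⟩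

theorem apply_mem_span_lowest
    (hI : IsIntertwiningOperator W₁.toVOSAModule W₂.toVOSAModule W₃.toVOSAModule I)
    {w : Irr c h₁ q₁} {a n : ℂ} (hw : w ∈ wt c h₁ q₁ a) (hn : n = a + h₂ - h₃ - 1)
    {v : Irr c h₂ q₂} (hv : v ∈ Submodule.span ℂ {lowest c h₂ q₂}) :
    I n w v ∈ Submodule.span ℂ {lowest c h₃ q₃} := by
  have hv' : v ∈ wt c h₂ q₂ h₂ := (Submodule.span_singleton_le_iff_mem _ _).2 lowest_mem_wt hv
  have := apply_mem_wt hI hw hv' n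
  rw [hn] at this ⊢
  exact mem_span_lowest (by convert this using 1; ring_nf)

/-- The leading coefficients respect the `J(0)`-charges. -/
theorem apply_eq_zero_of_charge_ne
    (hI : IsIntertwiningOperator W₁.toVOSAModule W₂.toVOSAModule W₃.toVOSAModule I)
    {w : Irr c h₁ q₁} {a b n : ℂ} (hw : w ∈ wt c h₁ q₁ a) (hn : n = a + h₂ - h₃ - 1)
    (hJ : act (.J 0) w = b • w) (hb : q₃ ≠ b + q₂) : I n w (lowest c h₂ q₂) = 0 := by
  obtain ⟨r, hr⟩ := Submodule.mem_span_singleton.1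
    (apply_mem_span_lowest hI hw hn (Submodule.mem_span_singleton_self _))
  have h1 := act_J_zero_apply hI w (lowest c h₂ q₂) n
  have h2 : act (.J 0) (I n w (lowest c h₂ q₂)) = q₃ • I n w (lowest c h₂ q₂) := by
    rw [← hr, map_smul, act_J_zero_lowest, smul_comm]
  rw [h2, hJ, act_J_zero_lowest, map_smul, map_smul, LinearMap.smul_apply] at h1
  have h3 : (q₃ - (b + q₂)) • I n w (lowest c h₂ q₂) = 0 := by
    rw [← sub_eq_zero] at h1
    rw [← h1]
    module
  exact (smul_eq_zero.1 h3).resolve_left (sub_ne_zero.2 hb)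

theorem act_J_zero_act_Gp {w : Irr c h₁ q₁} {b : ℂ} (hw : act (.J 0) w = b • w) (k : ℤ) :
    act (.J 0) (act (.Gp k) w) = (b + 1) • act (.Gp k) w := by
  have h := sub_eq_iff_eq_add.1 (J_bracket_Gp 0 k)
  rw [act_apply, act_apply, ← mul_smul, h, zero_add, add_smul, mul_smul, ← act_apply (.J 0) w, hw]
  rw [← act_apply, ← act_apply, map_smul]
  module

theorem act_J_zero_act_Gm {w : Irr c h₁ q₁} {b : ℂ} (hw : act (.J 0) w = b • w) (k : ℤ) :
    act (.J 0) (act (.Gm k) w) = (b - 1) • act (.Gm k) w := by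
  have h := sub_eq_iff_eq_add.1 (J_bracket_Gm 0 k)
  rw [act_apply, act_apply, ← mul_smul, h, zero_add, add_smul, neg_smul, mul_smul,
    ← act_apply (.J 0) w, hw]
  rw [← act_apply, ← act_apply, map_smul]
  module

theorem act_J_zero_act_Gp_act_Gm_lowest :
    act (.J 0) (act (.Gp (-1)) (act (.Gm (-1)) (lowest c h₁ q₁))) =
      q₁ • act (.Gp (-1)) (act (.Gm (-1)) (lowest c h₁ q₁)) := by
  have := act_J_zero_act_Gp (act_J_zero_act_Gm (act_J_zero_lowest (c := c) (h := h₁) (q := q₁))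
    (-1)) (-1)
  rwa [sub_add_cancel] at this

end LowestPart
end NS2

/-! ### Dimension bounds from `J(0)`-charges -/

namespace NS2

theorem eq_of_add_neg_one_smul_eq_zero {W₁ W₂ W₃ : Type*} [AddCommGroup W₁] [Module ℂ W₁]
    [AddCommGroup W₂] [Module ℂ W₂] [AddCommGroup W₃] [Module ℂ W₃]
    {I I' : ℂ → W₁ →ₗ[ℂ] W₂ →ₗ[ℂ] W₃} (h : I + (-1 : ℂ) • I' = 0) : I = I' := by
  refine funext fun n => LinearMap.ext fun w => LinearMap.ext fun v => ?_
  have h' : I n w v + (-1 : ℂ) • I' n w v = 0 := congrArg (fun J => J n w v) h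
  rwa [neg_one_smul, ← sub_eq_add_neg, sub_eq_zero] at h'

theorem rank_intertwiningOperators_le {V W₁ W₂ W₃ F : Type} [AddCommGroup V] [Module ℂ V]
    [AddCommGroup W₁] [Module ℂ W₁] [AddCommGroup W₂] [Module ℂ W₂] [AddCommGroup W₃] [Module ℂ W₃]
    [AddCommGroup F] [Module ℂ F] {A : VOSA V} {M₁ : VOSAModule W₁ A} {M₂ : VOSAModule W₂ A}
    {M₃ : VOSAModule W₃ A} (f : intertwiningOperators M₁ M₂ M₃ →ₗ[ℂ] F)
    (hf : ∀ I, f I = 0 → I.1 = 0) : Module.rank ℂ (intertwiningOperators M₁ M₂ M₃) ≤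
      Module.rank ℂ F := by
  refine LinearMap.rank_le_of_injective f fun I I' h => Subtype.ext ?_
  have h0 : f (I + (-1 : ℂ) • I') = 0 := by
    rw [map_add, map_smul, h]
    module
  exact eq_of_add_neg_one_smul_eq_zero (hf _ h0)

variable {c h₁ q₁ h₂ q₂ h₃ q₃ : ℂ} {A : IrrVOSA c}

/-- The coefficient of `𝒴(w, x)𝟏_{c,h₂,q₂}` along the lowest weight space, as a linear function
of `𝒴`. -/
def leadingCoeff (W₁ : IrrModule A h₁ q₁) (W₂ : IrrModule A h₂ q₂) (W₃ : IrrModule A h₃ q₃)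
    {w : Irr c h₁ q₁} {a : ℂ} (hw : w ∈ wt c h₁ q₁ a) :
    intertwiningOperators W₁.toVOSAModule W₂.toVOSAModule W₃.toVOSAModule →ₗ[ℂ]
      Submodule.span ℂ {lowest c h₃ q₃} where
  toFun I := ⟨I.1 (a + h₂ - h₃ - 1) w (lowest c h₂ q₂),
    apply_mem_span_lowest I.2 hw rfl (Submodule.mem_span_singleton_self _)⟩
  map_add' _ _ := rfl
  map_smul' _ _ := rfl

theorem rank_span_lowest_le : Module.rank ℂ (Submodule.span ℂ {lowest c h₃ q₃}) ≤ 1 :=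
  (rank_span_le _).trans (by simp)

theorem apply_eq_zero_of_leadingCoeff {W₁ : IrrModule A h₁ q₁} {W₂ : IrrModule A h₂ q₂}
    {W₃ : IrrModule A h₃ q₃} {w : Irr c h₁ q₁} {a n : ℂ} {hw : w ∈ wt c h₁ q₁ a}
    {I : intertwiningOperators W₁.toVOSAModule W₂.toVOSAModule W₃.toVOSAModule}
    (h : leadingCoeff W₁ W₂ W₃ hw I = 0) (hn : n = a + h₂ - h₃ - 1) :
    I.1 n w (lowest c h₂ q₂) = 0 := by
  rw [hn]
  exact congrArg Subtype.val h

/-- Of the charges `q₁`, `q₁ ± 1`, `q₁`, only that of `G⁺(-1/2)w` matches, so this one coefficient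
determines the operator. -/
theorem rank_intertwiningOperators_le_one_of_add (W₁ : IrrModule A h₁ q₁)
    (W₂ : IrrModule A h₂ q₂) (W₃ : IrrModule A h₃ q₃) (hq : q₃ = q₁ + q₂ + 1) :
    Module.rank ℂ (intertwiningOperators W₁.toVOSAModule W₂.toVOSAModule W₃.toVOSAModule) ≤ 1 := by
  refine (rank_intertwiningOperators_le (leadingCoeff W₁ W₂ W₃ act_Gp_lowest_mem_wt)
    fun I hI => ?_).trans rank_span_lowest_le
  refine eq_zero_of_leading_coeff_eq_zero I.2
    (apply_eq_zero_of_charge_ne I.2 lowest_mem_wt (by ring) act_J_zero_lowest fun h => ?_)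
    (apply_eq_zero_of_leadingCoeff hI (by ring))
    (apply_eq_zero_of_charge_ne I.2 act_Gm_lowest_mem_wt (by ring)
      (act_J_zero_act_Gm act_J_zero_lowest _) fun h => ?_)
    (apply_eq_zero_of_charge_ne I.2 act_Gp_act_Gm_lowest_mem_wt (by ring)
      act_J_zero_act_Gp_act_Gm_lowest fun h => ?_)
  · exact one_ne_zero (α := ℂ) (by linear_combination h - hq)
  · exact two_ne_zero (α := ℂ) (by linear_combination h - hq)
  · exact one_ne_zero (α := ℂ) (by linear_combination h - hq)

theorem rank_intertwiningOperators_le_one_of_sub (W₁ : IrrModule A h₁ q₁)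
    (W₂ : IrrModule A h₂ q₂) (W₃ : IrrModule A h₃ q₃) (hq : q₃ = q₁ + q₂ - 1) :
    Module.rank ℂ (intertwiningOperators W₁.toVOSAModule W₂.toVOSAModule W₃.toVOSAModule) ≤ 1 := by
  refine (rank_intertwiningOperators_le (leadingCoeff W₁ W₂ W₃ act_Gm_lowest_mem_wt)
    fun I hI => ?_).trans rank_span_lowest_le
  refine eq_zero_of_leading_coeff_eq_zero I.2
    (apply_eq_zero_of_charge_ne I.2 lowest_mem_wt (by ring) act_J_zero_lowest fun h => ?_)
    (apply_eq_zero_of_charge_ne I.2 act_Gp_lowest_mem_wt (by ring)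
      (act_J_zero_act_Gp act_J_zero_lowest _) fun h => ?_)
    (apply_eq_zero_of_leadingCoeff hI (by ring))
    (apply_eq_zero_of_charge_ne I.2 act_Gp_act_Gm_lowest_mem_wt (by ring)
      act_J_zero_act_Gp_act_Gm_lowest fun h => ?_)
  · exact one_ne_zero (α := ℂ) (by linear_combination hq - h)
  · exact two_ne_zero (α := ℂ) (by linear_combination hq - h)
  · exact one_ne_zero (α := ℂ) (by linear_combination hq - h)

/-- Two of the four vectors, `w` and `G⁺(-1/2)G⁻(-1/2)w`, have the matching charge `q₁`. -/
theorem rank_intertwiningOperators_le_two (W₁ : IrrModule A h₁ q₁)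
    (W₂ : IrrModule A h₂ q₂) (W₃ : IrrModule A h₃ q₃) (hq : q₃ = q₁ + q₂) :
    Module.rank ℂ (intertwiningOperators W₁.toVOSAModule W₂.toVOSAModule W₃.toVOSAModule) ≤ 2 := by
  have hrank : Module.rank ℂ (Submodule.span ℂ {lowest c h₃ q₃} ×
      Submodule.span ℂ {lowest c h₃ q₃}) ≤ 2 := by
    rw [rank_prod', ← one_add_one_eq_two]
    exact add_le_add rank_span_lowest_le rank_span_lowest_le
  refine (rank_intertwiningOperators_le ((leadingCoeff W₁ W₂ W₃ lowest_mem_wt).prod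
    (leadingCoeff W₁ W₂ W₃ act_Gp_act_Gm_lowest_mem_wt))
    fun I hI => ?_).trans hrank
  obtain ⟨hI0, hIpm⟩ := Prod.ext_iff.1 hI
  refine eq_zero_of_leading_coeff_eq_zero I.2
    (apply_eq_zero_of_leadingCoeff hI0 (by ring))
    (apply_eq_zero_of_charge_ne I.2 act_Gp_lowest_mem_wt (by ring)
      (act_J_zero_act_Gp act_J_zero_lowest _) fun h => ?_)
    (apply_eq_zero_of_charge_ne I.2 act_Gm_lowest_mem_wt (by ring)
      (act_J_zero_act_Gm act_J_zero_lowest _) fun h => ?_)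
    (apply_eq_zero_of_leadingCoeff hIpm (by ring))
  · exact one_ne_zero (α := ℂ) (by linear_combination hq - h)
  · exact one_ne_zero (α := ℂ) (by linear_combination h - hq)

theorem intertwiningOperators_eq_bot (W₁ : IrrModule A h₁ q₁) (W₂ : IrrModule A h₂ q₂)
    (W₃ : IrrModule A h₃ q₃) (h0 : q₃ ≠ q₁ + q₂) (hm : q₃ ≠ q₁ + q₂ - 1)
    (hp : q₃ ≠ q₁ + q₂ + 1) :
    intertwiningOperators W₁.toVOSAModule W₂.toVOSAModule W₃.toVOSAModule = ⊥ := by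
  rw [eq_bot_iff]
  intro I hI
  exact eq_zero_of_leading_coeff_eq_zero hI
    (apply_eq_zero_of_charge_ne hI lowest_mem_wt (by ring) act_J_zero_lowest h0)
    (apply_eq_zero_of_charge_ne hI act_Gp_lowest_mem_wt (by ring)
      (act_J_zero_act_Gp act_J_zero_lowest _) fun h => hp (by linear_combination h))
    (apply_eq_zero_of_charge_ne hI act_Gm_lowest_mem_wt (by ring)
      (act_J_zero_act_Gm act_J_zero_lowest _) fun h => hm (by linear_combination h))
    (apply_eq_zero_of_charge_ne hI act_Gp_act_Gm_lowest_mem_wt (by ring)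
      act_J_zero_act_Gp_act_Gm_lowest h0)

end NS2

end

theorem proposition2p2 (m : ℕ) (j₁ k₁ j₂ k₂ j₃ k₃ : ℚ)
    (hj₁ : j₁ ∈ NHalf) (hk₁ : k₁ ∈ NHalf) (hjk₁ : j₁ + k₁ < m + 2)
    (hj₂ : j₂ ∈ NHalf) (hk₂ : k₂ ∈ NHalf) (hjk₂ : j₂ + k₂ < m + 2)
    (hj₃ : j₃ ∈ NHalf) (hk₃ : k₃ ∈ NHalf) (hjk₃ : j₃ + k₃ < m + 2)
    (h₁ q₁ h₂ q₂ h₃ q₃ Δ : ℂ)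
    (hh₁ : h₁ = hMin m j₁ k₁) (hq₁ : q₁ = qMin m j₁ k₁)
    (hh₂ : h₂ = hMin m j₂ k₂) (hq₂ : q₂ = qMin m j₂ k₂)
    (hh₃ : h₃ = hMin m j₃ k₃) (hq₃ : q₃ = qMin m j₃ k₃)
    (hΔ : Δ = h₃ - h₁ - h₂)
    (V : IrrVOSA (cMin m)) (W₁ : IrrModule V h₁ q₁) (W₂ : IrrModule V h₂ q₂)
    (W₃ : IrrModule V h₃ q₃)
    (w₁ : NS2.Irr (cMin m) h₁ q₁) (w₂ : NS2.Irr (cMin m) h₂ q₂) (w₃ : NS2.Irr (cMin m) h₃ q₃)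
    (hw₁ : w₁ = NS2.lowest (cMin m) h₁ q₁) (hw₂ : w₂ = NS2.lowest (cMin m) h₂ q₂)
    (hw₃ : w₃ = NS2.lowest (cMin m) h₃ q₃)
    (𝒱 : Submodule ℂ (ℂ → NS2.Irr (cMin m) h₁ q₁ →ₗ[ℂ] NS2.Irr (cMin m) h₂ q₂ →ₗ[ℂ]
      NS2.Irr (cMin m) h₃ q₃))
    (h𝒱 : 𝒱 = intertwiningOperators W₁.toVOSAModule W₂.toVOSAModule W₃.toVOSAModule) :
    -- `𝒴(w, x)v ∈ x^Δ W₃((x^{1/2}))`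
    (∀ I ∈ 𝒱, ∀ w v, ∃ N : ℤ, ∀ n : ℂ, I n w v ≠ 0 → ∃ p : ℤ, N ≤ p ∧ -n - 1 = Δ + p / 2) ∧
    -- the four coefficients map `ℂ w₂` to `ℂ w₃`
    (∀ I ∈ 𝒱, ∀ v ∈ Submodule.span ℂ {w₂},
      I (-Δ - 1) w₁ v ∈ Submodule.span ℂ {w₃} ∧
      I (-Δ - 1 / 2) (NS2.act (.Gp (-1)) w₁) v ∈ Submodule.span ℂ {w₃} ∧
      I (-Δ - 1 / 2) (NS2.act (.Gm (-1)) w₁) v ∈ Submodule.span ℂ {w₃} ∧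
      I (-Δ) (NS2.act (.Gp (-1)) (NS2.act (.Gm (-1)) w₁)) v ∈ Submodule.span ℂ {w₃}) ∧
    -- these four maps determine `𝒴`
    (∀ I ∈ 𝒱, ∀ I' ∈ 𝒱,
      (∀ v ∈ Submodule.span ℂ {w₂},
        I (-Δ - 1) w₁ v = I' (-Δ - 1) w₁ v ∧
        I (-Δ - 1 / 2) (NS2.act (.Gp (-1)) w₁) v = I' (-Δ - 1 / 2) (NS2.act (.Gp (-1)) w₁) v ∧
        I (-Δ - 1 / 2) (NS2.act (.Gm (-1)) w₁) v = I' (-Δ - 1 / 2) (NS2.act (.Gm (-1)) w₁) v ∧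
        I (-Δ) (NS2.act (.Gp (-1)) (NS2.act (.Gm (-1)) w₁)) v =
          I' (-Δ) (NS2.act (.Gp (-1)) (NS2.act (.Gm (-1)) w₁)) v) →
      I = I') ∧
    -- if they are zero, then `𝒴 = 0`
    (∀ I ∈ 𝒱,
      (∀ v ∈ Submodule.span ℂ {w₂},
        I (-Δ - 1) w₁ v = 0 ∧
        I (-Δ - 1 / 2) (NS2.act (.Gp (-1)) w₁) v = 0 ∧
        I (-Δ - 1 / 2) (NS2.act (.Gm (-1)) w₁) v = 0 ∧
        I (-Δ) (NS2.act (.Gp (-1)) (NS2.act (.Gm (-1)) w₁)) v = 0) →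
      I = 0) ∧
    -- the dimension of the space of intertwining operators
    ((q₃ ≠ q₁ + q₂ ∧ q₃ ≠ q₁ + q₂ - 1 ∧ q₃ ≠ q₁ + q₂ + 1) → 𝒱 = ⊥) ∧
    ((q₃ = q₁ + q₂ + 1 ∨ q₃ = q₁ + q₂ - 1) → Module.rank ℂ 𝒱 ≤ 1) ∧
    (q₃ = q₁ + q₂ → Module.rank ℂ 𝒱 ≤ 2) := by
  subst hw₁ hw₂ hw₃ h𝒱 hΔ
  have key : ∀ I ∈ intertwiningOperators W₁.toVOSAModule W₂.toVOSAModule W₃.toVOSAModule,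
      (∀ v ∈ Submodule.span ℂ {NS2.lowest (cMin m) h₂ q₂},
        I (-(h₃ - h₁ - h₂) - 1) (NS2.lowest (cMin m) h₁ q₁) v = 0 ∧
        I (-(h₃ - h₁ - h₂) - 1 / 2) (NS2.act (.Gp (-1)) (NS2.lowest (cMin m) h₁ q₁)) v = 0 ∧
        I (-(h₃ - h₁ - h₂) - 1 / 2) (NS2.act (.Gm (-1)) (NS2.lowest (cMin m) h₁ q₁)) v = 0 ∧
        I (-(h₃ - h₁ - h₂))
          (NS2.act (.Gp (-1)) (NS2.act (.Gm (-1)) (NS2.lowest (cMin m) h₁ q₁))) v = 0) →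
      I = 0 := fun I hI h => by
    obtain ⟨h0, hp, hm, hpm⟩ := h _ (Submodule.mem_span_singleton_self _)
    exact NS2.eq_zero_of_leading_coeff_eq_zero hI h0 hp hm hpm
  refine ⟨fun I hI w v => NS2.exists_exponent_bound hI w v, fun I hI v hv => ⟨?_, ?_, ?_, ?_⟩,
    fun I hI I' hI' h => ?_, key, fun h => ?_, ?_, ?_⟩
  · exact NS2.apply_mem_span_lowest hI NS2.lowest_mem_wt (by ring) hv
  · exact NS2.apply_mem_span_lowest hI NS2.act_Gp_lowest_mem_wt (by ring) hv
  · exact NS2.apply_mem_span_lowest hI NS2.act_Gm_lowest_mem_wt (by ring) hv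
  · exact NS2.apply_mem_span_lowest hI NS2.act_Gp_act_Gm_lowest_mem_wt (by ring) hv
  -- Uniqueness is the vanishing criterion `key` applied to the difference of the two operators.
  · refine NS2.eq_of_add_neg_one_smul_eq_zero
      (key _ (add_mem hI (Submodule.smul_mem _ (-1) hI')) fun v hv => ?_)
    obtain ⟨h0, hp, hm, hpm⟩ := h v hv
    have cancel : ∀ {x y : NS2.Irr (cMin m) h₃ q₃}, x = y → x + (-1 : ℂ) • y = 0 :=
      fun {x y} hxy => by rw [hxy]; module
    exact ⟨cancel h0, cancel hp, cancel hm, cancel hpm⟩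
  · exact NS2.intertwiningOperators_eq_bot W₁ W₂ W₃ h.1 h.2.1 h.2.2
  · rintro (h | h)
    · exact NS2.rank_intertwiningOperators_le_one_of_add W₁ W₂ W₃ h
    · exact NS2.rank_intertwiningOperators_le_one_of_sub W₁ W₂ W₃ h
  · exact NS2.rank_intertwiningOperators_le_two W₁ W₂ W₃
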